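/- Consider a robotic system with state $q\in\mathbb R^n$ and actuator velocities $J(q)\dot q\in\mathbb R^m$, moving along a $C^2$ path $q(s)$, $s\in[0,s_e]$, $s_e>0$, such that $s\mapsto J(q(s))$ is $C^1$ and $a(s):=J(q(s))q_s(s)\neq 0$ for all $s$. Put $b(s):=J_s q_s+J(q(s))q_{ss}$. The actuator constraints are $|a_j(s)\dot s|\le v_{\max,j}$ and $|a_j(s)\ddot s+b_j(s)\dot s^2|\le a_{\max,j}$ ($1\le j\le m$), with positive bounds; the starting and terminal path velocities are $\dot s_0,\dot s_e\ge 0$. A trajectory is a velocity profile $\dot s=v(s)\ge 0$ on $[0,s_e]$ with $v(0)=\dot s_0$, $v(s_e)=\dot s_e$ and $v^2/2$ absolutely continuous, the path acceleration being $\ddot s=(v^2/2)'$; it is admissible if it satisfies the velocity constraints everywhere and the acceleration constraints for almost every $s$. Its traveling time is $T=\int_0^{s_e}ds/v(s)\in[0,\infty]$. The time-optimal motion is an admissible trajectory with the smallest $T$ among all admissible ones. With $A=(a,-a)$, $B=(b,-b)$, $C=(-a_{\max},-a_{\max})$, $D=(-v_{\max},-v_{\max})$ let $$\alpha(s,\dot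 s)=\max_{A_i(s)<0}\frac{-B_i(s)\dot s^2-C_i}{A_i(s)},\qquad \beta(s,\dot s)=\min_{A_i(s)>0}\frac{-B_i(s)\dot s^2-C_i}{A_i(s)},$$ $$MVC(s)=\min\Bigl(\min\{\dot s\ge 0:\alpha(s,\dot s)=\beta(s,\dot s)\},\ \min_{A_i(s)>0}\frac{-D_i}{A_i(s)}\Bigr),$$ where the minimum of the empty set is $+\infty$, let $\mathrm{Max}(MVC)=\sup_{[0,s_e]}MVC$ and, for $\varepsilon\in[\max(\dot s_0,\dot s_e),\mathrm{Max}(MVC)]$, let $MVC^*(s)=\min(MVC(s),\varepsilon)$. An admissible trajectory is feasible under $MVC^*$ if $v\le MVC^*$ on $[0,s_e]$. A trajectory $\Omega$ of complete numerical integration (CNI) for $\varepsilon$ is a feasible trajectory under $MVC^*$ composed of finitely many pieces, each of which is an accelerating profile ($\ddot s=\beta$) that starts at $s=0$ or at a point of the curve $MVC^*$, or a decelerating profile ($\ddot s=\alpha$) that ends at $s=s_e$ or at a point of the curve $MVC^*$, or a switch arc ($v=MVC^*$). Here the curve $MVC^*$ is understood as the closure of its graph. The bidirectional integration operation (BIO)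 replaces $\Omega$, in one window $[s_{p_2},s_{p_3}]$ around each intersection point $p_1$ (accelerating profile with switch arc, switch arc with decelerating profile, accelerating with decelerating profile), by profiles integrated forward from $p_2$ and backward from $p_3$ up to $s_{p_1}$ with path acceleration $$\beta^*-\frac{(s-s_{p_2})(\beta^*-\alpha^*)}{s_{p_3}-s_{p_2}}=\alpha^*+\frac{(s_{p_3}-s)(\beta^*-\alpha^*)}{s_{p_3}-s_{p_2}},\qquad \beta^*=\alpha+(\beta-\alpha)\delta_1,\quad \alpha^*=\alpha+(\beta-\alpha)\delta_2,$$ where $\delta_1,\delta_2$ are the values of $(\ddot s-\alpha)/(\beta-\alpha)$ on $\Omega$ at $p_2$ and $p_3$; the windows contain no other breakpoint of $\Omega$ and do not overlap, and the result is required to be a feasible trajectory under $MVC^*$. Then, for $\varepsilon,\varepsilon_1,\varepsilon_2\in[\max(\dot s_0,\dot s_e),\mathrm{Max}(MVC)]$ and CNI trajectories $\Omega,\Omega_1,\Omega_2$ for $\varepsilon,\varepsilon_1,\varepsilon_2$ respectively: 1. $\Omega$ has the smallest traveling time among all trajectories that are feasible under $MVC^*$. 2. If $\varepsilon_2<\varepsilon_1$,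 then $T(\Omega_1)\le T(\Omega_2)$, and $T(\Omega_1)<T(\Omega_2)$ unless $\Omega_2$ is already the time-optimal motion. 3. If $\varepsilon=\mathrm{Max}(MVC)$, then $\Omega$ is the time-optimal motion. 4. If $\varepsilon_2<\varepsilon_1$ and $\Omega_2$ is not the time-optimal motion, then there is $\delta>0$ such that $T(\Gamma_1)<T(\Gamma_2)$ whenever $\Gamma_1$ results from $\Omega_1$ by BIO with windows shorter than $\delta$ and $\Gamma_2$ results from $\Omega_2$ by BIO. 5. For every $\eta>0$ there is $\delta>0$ such that $T(\Omega)\le T(\Gamma)\le T(\Omega)+\eta$ for every $\Gamma$ that results from $\Omega$ by BIO with windows shorter than $\delta$. -/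

import Mathlib

open Set MeasureTheory
open scoped ENNReal

noncomputable section

/-- A path-constrained trajectory planning problem: actuator velocities are `J(q) q̇`, the path is
`q(s)`, `s ∈ [0, se]`, the actuators have velocity and acceleration bounds, and the starting and
terminal path velocities are prescribed.  `regular` says that the actuators move along the path
(some row of `A(s)` is positive, so that the minima and maxima below are over non-empty sets). -/
structure PathProblem (m n : ℕ) where
  J : (Fin n → ℝ) → Matrix (Fin m) (Fin n) ℝ
  q : ℝ → Fin n → ℝ
  se : ℝ
  v0 : ℝ
  ve : ℝ
  vmax : Fin m → ℝ
  amax : Fin m → ℝ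
  se_pos : 0 < se
  v0_nonneg : 0 ≤ v0
  ve_nonneg : 0 ≤ ve
  vmax_pos : ∀ j, 0 < vmax j
  amax_pos : ∀ j, 0 < amax j
  q_smooth : ContDiffOn ℝ 2 q (Icc 0 se)
  J_smooth : ∀ j k, ContDiffOn ℝ 1 (fun s => J (q s) j k) (Icc 0 se)
  regular : ∀ s ∈ Icc 0 se, (J (q s)).mulVec (derivWithin q (Icc 0 se) s) ≠ 0

/-- A velocity profile in the phase plane: path velocity and path acceleration as functions of the
path coordinate. -/
structure Profile where
  v : ℝ → ℝ
  acc : ℝ → ℝ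

/-- The three kinds of pieces of which a trajectory of complete numerical integration consists. -/
inductive PieceKind where
  | accel
  | decel
  | switchArc

/-- The three cases of intersection: accelerating profile with switch arc, switch arc with
decelerating profile, accelerating profile with decelerating profile. -/
def IsIntersection : PieceKind → PieceKind → Prop
  | .accel, .switchArc => True
  | .switchArc, .decel => True
  | .accel, .decel => True
  | _, _ => False

namespace PathProblem

variable {m n : ℕ} (P : PathProblem m n)

/-- `q_s`. -/
def qs (s : ℝ) : Fin n → ℝ := derivWithin P.q (Icc 0 P.se) s

/-- `q_ss`. -/
def qss (s : ℝ) : Fin n → ℝ := derivWithin P.qs (Icc 0 P.se) s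

/-- `J_s`, the derivative of `s ↦ J(q(s))`. -/
def Js (s : ℝ) : Matrix (Fin m) (Fin n) ℝ :=
  fun j k => derivWithin (fun σ => P.J (P.q σ) j k) (Icc 0 P.se) s

/-- `J(q(s)) q_s`. -/
def a (s : ℝ) : Fin m → ℝ := (P.J (P.q s)).mulVec (P.qs s)

/-- `J_s q_s + J(q(s)) q_ss`. -/
def b (s : ℝ) : Fin m → ℝ := (P.Js s).mulVec (P.qs s) + (P.J (P.q s)).mulVec (P.qss s)

/-- Actuator velocity at path coordinate `s` and path velocity `v`. -/
def actuatorVelocity (s v : ℝ) (j : Fin m) : ℝ := P.a s j * v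

/-- Actuator acceleration at path coordinate `s`, path velocity `v`, path acceleration `x`. -/
def actuatorAcceleration (s v x : ℝ) (j : Fin m) : ℝ := P.a s j * x + P.b s j * v ^ 2

/-- Stacked coefficient vectors `A(s), B(s), C(s), D(s)` of the `2m` inequalities. -/
def A (s : ℝ) : Fin m ⊕ Fin m → ℝ := Sum.elim (P.a s) (-P.a s)
def B (s : ℝ) : Fin m ⊕ Fin m → ℝ := Sum.elim (P.b s) (-P.b s)
def C : Fin m ⊕ Fin m → ℝ := Sum.elim (-P.amax) (-P.amax)
def D : Fin m ⊕ Fin m → ℝ := Sum.elim (-P.vmax) (-P.vmax)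

/-- Minimum path acceleration `α(s, v)` (a maximum over a finite set). -/
def α (s v : ℝ) : ℝ :=
  sSup {x | ∃ i, P.A s i < 0 ∧ x = (-P.B s i * v ^ 2 - P.C i) / P.A s i}

/-- Maximum path acceleration `β(s, v)` (a minimum over a finite set). -/
def β (s v : ℝ) : ℝ :=
  sInf {x | ∃ i, 0 < P.A s i ∧ x = (-P.B s i * v ^ 2 - P.C i) / P.A s i}

/-- Velocity limit curve of the velocity constraints (a minimum over a finite set). -/
def MVCV (s : ℝ) : ℝ := sInf {x | ∃ i, 0 < P.A s i ∧ x = -P.D i / P.A s i}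

/-- Velocity limit curve of the acceleration constraints, `+∞` where `α = β` never happens. -/
def MVCA (s : ℝ) : EReal := sInf ((fun v : ℝ => (v : EReal)) '' {v | 0 ≤ v ∧ P.α s v = P.β s v})

/-- Maximum velocity curve (finite, since `MVCV` is). -/
def MVC (s : ℝ) : ℝ := (min (P.MVCA s) (P.MVCV s : EReal)).toReal

/-- `Max(MVC)`. -/
def maxMVC : ℝ := sSup (P.MVC '' Icc 0 P.se)

/-- The maximum velocity curve reconstructed with the velocity limit line `M(s) = ε`. -/
def MVCstar (ε s : ℝ) : ℝ := min (P.MVC s) ε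

/-- The range of the functional parameter. -/
def paramRange : Set ℝ := Icc (max P.v0 P.ve) P.maxMVC

/-- Velocity profiles along the path from `v0` to `ve`: `v ≥ 0`, and `v² / 2` is absolutely
continuous with derivative the path acceleration (that is, `s̈ = ṡ dṡ/ds`). -/
structure IsProfile (Γ : Profile) : Prop where
  nonneg : ∀ s ∈ Icc 0 P.se, 0 ≤ Γ.v s
  start : Γ.v 0 = P.v0
  terminal : Γ.v P.se = P.ve
  integrable : IntervalIntegrable Γ.acc volume 0 P.se
  energy : ∀ s ∈ Icc 0 P.se, Γ.v s ^ 2 / 2 = P.v0 ^ 2 / 2 + ∫ σ in (0 : ℝ)..s, Γ.acc σ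

/-- Profiles that satisfy the actuator constraints. -/
structure IsAdmissible (Γ : Profile) : Prop extends P.IsProfile Γ where
  velocity : ∀ s ∈ Icc 0 P.se, ∀ j, -P.vmax j ≤ P.actuatorVelocity s (Γ.v s) j ∧
    P.actuatorVelocity s (Γ.v s) j ≤ P.vmax j
  acceleration : ∀ᵐ s ∂(volume.restrict (Icc 0 P.se)), ∀ j,
    -P.amax j ≤ P.actuatorAcceleration s (Γ.v s) (Γ.acc s) j ∧
    P.actuatorAcceleration s (Γ.v s) (Γ.acc s) j ≤ P.amax j

/-- Profiles that satisfy the actuator constraints and stay under `MVC*`. -/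
structure IsFeasibleUnder (ε : ℝ) (Γ : Profile) : Prop extends P.IsAdmissible Γ where
  under : ∀ s ∈ Icc 0 P.se, Γ.v s ≤ P.MVCstar ε s

/-- Traveling time `∫ ds / ṡ`, with `1 / 0 = ∞`. -/
def travelTime (Γ : Profile) : ℝ≥0∞ := ∫⁻ s in Icc 0 P.se, (ENNReal.ofReal (Γ.v s))⁻¹

/-- Time-optimality under `MVC*`. -/
def IsTimeOptimalUnder (ε : ℝ) (Γ : Profile) : Prop :=
  P.IsFeasibleUnder ε Γ ∧ ∀ Γ', P.IsFeasibleUnder ε Γ' → P.travelTime Γ ≤ P.travelTime Γ'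

/-- The time-optimal motion of the robotic system: only the actuator constraints are imposed. -/
def IsTimeOptimalMotion (Γ : Profile) : Prop :=
  P.IsAdmissible Γ ∧ ∀ Γ', P.IsAdmissible Γ' → P.travelTime Γ ≤ P.travelTime Γ'

/-- The point `(s, x)` of the phase plane lies on the curve `MVC*`; the closure of the graph takes
care of the points where the curve is discontinuous. -/
def OnMVCstar (ε s x : ℝ) : Prop :=
  (s, x) ∈ closure ((fun σ => (σ, P.MVCstar ε σ)) '' Icc 0 P.se)

/-- A trajectory of complete numerical integration under `MVC*`: a feasible trajectory composed of
finitely many pieces `[t k, t (k+1)]`, each of which is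
* part of an accelerating profile, integrated forward with `s̈ = β` from the starting point or from
  a point of `MVC*` (a switch point or the right endpoint of a switch arc), or
* part of a decelerating profile, integrated backward with `s̈ = α` from the terminal point or from
  a point of `MVC*` (a switch point or the left endpoint of a switch arc), or
* a switch arc, that is, a part of `MVC*` which satisfies the constraints. -/
structure CNITrajectory (ε : ℝ) extends Profile where
  feasible : P.IsFeasibleUnder ε toProfile
  N : ℕ
  t : ℕ → ℝ
  kind : ℕ → PieceKind
  t_zero : t 0 = 0
  t_last : t N = P.se
  t_lt : ∀ k < N, t k < t (k + 1)
  accel_piece : ∀ k < N, kind k = .accel →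
    (∀ᵐ s ∂(volume.restrict (Icc (t k) (t (k + 1)))), acc s = P.β s (v s)) ∧
    (t k = 0 ∨ P.OnMVCstar ε (t k) (v (t k)))
  decel_piece : ∀ k < N, kind k = .decel →
    (∀ᵐ s ∂(volume.restrict (Icc (t k) (t (k + 1)))), acc s = P.α s (v s)) ∧
    (t (k + 1) = P.se ∨ P.OnMVCstar ε (t (k + 1)) (v (t (k + 1))))
  switchArc_piece : ∀ k < N, kind k = .switchArc →
    ∀ s ∈ Ioo (t k) (t (k + 1)), v s = P.MVCstar ε s

/-- `α + (β - α) δ` with the ratio `δ` of the point `(sp, vp)` with path acceleration `xp`. -/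
def blend (sp vp xp s v : ℝ) : ℝ :=
  P.α s v + (P.β s v - P.α s v) * ((xp - P.α sp vp) / (P.β sp vp - P.α sp vp))

/-- Path acceleration of the forward integration from `p₂ = (s₂, v₂)`, where the path acceleration
is `x₂`, towards `p₃ = (s₃, v₃)`, where it is `x₃`. -/
def forwardAcc (s₂ v₂ x₂ s₃ v₃ x₃ s v : ℝ) : ℝ :=
  P.blend s₂ v₂ x₂ s v -
    (s - s₂) * (P.blend s₂ v₂ x₂ s v - P.blend s₃ v₃ x₃ s v) / (s₃ - s₂)

/-- Path acceleration of the backward integration from `p₃`. -/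
def backwardAcc (s₂ v₂ x₂ s₃ v₃ x₃ s v : ℝ) : ℝ :=
  P.blend s₃ v₃ x₃ s v +
    (s₃ - s) * (P.blend s₂ v₂ x₂ s v - P.blend s₃ v₃ x₃ s v) / (s₃ - s₂)

/-- The intersection points of a trajectory of complete numerical integration: those `t (k+1)` at
which the pieces `k` and `k+1` meet in one of the three intersection cases. -/
def CNITrajectory.IntersectsAt {P : PathProblem m n} {ε : ℝ} (Ω : P.CNITrajectory ε) (k : ℕ) :
    Prop :=
  k + 1 < Ω.N ∧ IsIntersection (Ω.kind k) (Ω.kind (k + 1))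

/-- Output of the bidirectional integration operation on `Ω`: a feasible trajectory under `MVC*`.
Around each intersection point `t (k+1)` a window `[l k, r k]` of length less than `δ` is chosen
which contains no other breakpoint; different windows do not overlap.  Outside the windows nothing
changes.  In a window the profile is integrated forward from its left end and backward from its
right end, up to the intersection coordinate, where the two parts join. -/
structure IsSmoothing {P : PathProblem m n} {ε : ℝ} (Ω : P.CNITrajectory ε) (δ : ℝ)
    (l r : ℕ → ℝ) (Γ : Profile) : Prop where
  feasible : P.IsFeasibleUnder ε Γ
  left_window : ∀ k, Ω.IntersectsAt k → Ω.t k < l k ∧ l k < Ω.t (k + 1)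
  right_window : ∀ k, Ω.IntersectsAt k → Ω.t (k + 1) < r k ∧ r k < Ω.t (k + 2)
  short : ∀ k, Ω.IntersectsAt k → r k - l k < δ
  disjoint : ∀ k, Ω.IntersectsAt k → Ω.IntersectsAt (k + 1) → r k ≤ l (k + 1)
  unchanged : ∀ s ∈ Icc 0 P.se, (∀ k, Ω.IntersectsAt k → s ∉ Ioo (l k) (r k)) → Γ.v s = Ω.v s
  smoothed : ∀ k, Ω.IntersectsAt k → ∃ x₂ x₃ : ℝ,
    HasDerivAt (fun s => Ω.v s ^ 2 / 2) x₂ (l k) ∧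
    HasDerivAt (fun s => Ω.v s ^ 2 / 2) x₃ (r k) ∧
    (∀ᵐ s ∂(volume.restrict (Icc (l k) (Ω.t (k + 1)))), Γ.acc s =
      P.forwardAcc (l k) (Ω.v (l k)) x₂ (r k) (Ω.v (r k)) x₃ s (Γ.v s)) ∧
    (∀ᵐ s ∂(volume.restrict (Icc (Ω.t (k + 1)) (r k))), Γ.acc s =
      P.backwardAcc (l k) (Ω.v (l k)) x₂ (r k) (Ω.v (r k)) x₃ s (Γ.v s))

/-- `Γ` is generated from `Ω` by the bidirectional integration operation with windows shorter
than `δ`. -/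
def SmoothedFrom {P : PathProblem m n} {ε : ℝ} (Ω : P.CNITrajectory ε) (δ : ℝ) (Γ : Profile) :
    Prop :=
  ∃ l r : ℕ → ℝ, IsSmoothing Ω δ l r Γ

/-- `Γ` is generated from `Ω` by the bidirectional integration operation. -/
def IsGeneratedFrom {P : PathProblem m n} {ε : ℝ} (Ω : P.CNITrajectory ε) (Γ : Profile) : Prop :=
  ∃ δ, SmoothedFrom Ω δ Γ

end PathProblem

end

section

open Filter Topology

namespace PathProblem

variable {m n : ℕ} (P : PathProblem m n)

/-! The core is a comparison principle: a CNI trajectory Ω is pointwise the fastest profile under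
`MVC*`, and a pointwise larger velocity gives a smaller traveling time. On an accelerating piece a
competitor Γ starts no higher than Ω, and the difference of the squared velocities, wherever
positive, grows at a rate at most proportional to its size, so a Gronwall argument keeps it
nonpositive. Decelerating pieces are treated backward, and a switch arc is the bound itself. The
growth estimate needs β and α to be only one-sided Lipschitz in v², which survives zeros of the
coefficients a_j (`exists_oneSided_lipschitz`).

Monotonicity in ε is inclusion of the feasible sets. For strictness, T(Ω₁) is finite because v²
grows at least linearly away from the ends of the path (`exists_energy_lower_bound`). If T(Ω₁) =
T(Ω₂), the two ordered continuous profiles coincide, so Ω₁ ≤ ε₂ < ε₁ never meets its own level line.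
The comparison then covers all admissible trajectories, since these lie under MVC anyway
(`IsAdmissible.le_MVC`). The same fact settles ε = Max(MVC).

Smoothing changes Ω only inside the windows. The velocity of Ω at interior breakpoints is positive
and v² is uniformly Lipschitz, so each short window costs a time at most proportional to its length.
-/

/-- Largest path acceleration that actuator `j` permits at path velocity `v`. -/
noncomputable def accMax (s v : ℝ) (j : Fin m) : ℝ := P.amax j / |P.a s j| - P.b s j / P.a s j * v ^ 2

/-- Smallest path acceleration that actuator `j` permits at path velocity `v`. -/
noncomputable def accMin (s v : ℝ) (j : Fin m) : ℝ := -(P.amax j / |P.a s j|) - P.b s j / P.a s j * v ^ 2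

/-! ### Continuity and uniform bounds of the coefficients along the path -/

section Coefficients

theorem uniqueDiffOn_path : UniqueDiffOn ℝ (Icc 0 P.se) := uniqueDiffOn_Icc P.se_pos

theorem continuousOn_qs : ContinuousOn P.qs (Icc 0 P.se) :=
  P.q_smooth.continuousOn_derivWithin P.uniqueDiffOn_path (by norm_num)

theorem continuousOn_qss : ContinuousOn P.qss (Icc 0 P.se) :=
  (P.q_smooth.derivWithin P.uniqueDiffOn_path (m := 1) (by norm_num)).continuousOn_derivWithin
    P.uniqueDiffOn_path le_rfl

theorem continuousOn_a (j : Fin m) : ContinuousOn (fun s => P.a s j) (Icc 0 P.se) := by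
  have hq := P.continuousOn_qs
  simp only [PathProblem.a, Matrix.mulVec, dotProduct]
  exact continuousOn_finsetSum _ fun k _ =>
    (P.J_smooth j k).continuousOn.mul ((continuous_apply k).comp_continuousOn hq)

theorem continuousOn_b (j : Fin m) : ContinuousOn (fun s => P.b s j) (Icc 0 P.se) := by
  have hq := P.continuousOn_qs
  have hqq := P.continuousOn_qss
  simp only [PathProblem.b, Matrix.mulVec, dotProduct, Pi.add_apply]
  refine (continuousOn_finsetSum _ fun k _ => ?_).add (continuousOn_finsetSum _ fun k _ => ?_)
  · exact ((P.J_smooth j k).continuousOn_derivWithin P.uniqueDiffOn_path le_rfl).mul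
      ((continuous_apply k).comp_continuousOn hq)
  · exact (P.J_smooth j k).continuousOn.mul ((continuous_apply k).comp_continuousOn hqq)

theorem nonempty_path : (Icc 0 P.se).Nonempty := nonempty_Icc.2 P.se_pos.le

/-- Compactness applies to the sup norm of `a`, which never vanishes. Single components may vanish,
so the index depends on `s`. -/
theorem exists_lower_bound_a :
    ∃ c > 0, ∀ s ∈ Icc 0 P.se, ∃ j, c ≤ |P.a s j| := by
  have hc : ContinuousOn (fun s => ‖P.a s‖) (Icc 0 P.se) :=
    (continuousOn_pi.2 P.continuousOn_a).norm
  obtain ⟨s₀, hs₀, hmin⟩ := isCompact_Icc.exists_isMinOn P.nonempty_path hc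
  have hpos : 0 < ‖P.a s₀‖ := norm_pos_iff.2 (P.regular s₀ hs₀)
  refine ⟨_, hpos, fun s hs => ?_⟩
  by_contra! h
  exact absurd ((pi_norm_lt_iff hpos).2 h) (not_lt.2 (hmin hs))

theorem exists_upper_bound_ab :
    ∃ M > 0, ∀ s ∈ Icc 0 P.se, ∀ j, |P.a s j| ≤ M ∧ |P.b s j| ≤ M := by
  obtain ⟨M₁, h₁⟩ := isCompact_Icc.exists_bound_of_continuousOn
    (continuousOn_pi.2 P.continuousOn_a : ContinuousOn P.a (Icc 0 P.se))
  obtain ⟨M₂, h₂⟩ := isCompact_Icc.exists_bound_of_continuousOn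
    (continuousOn_pi.2 P.continuousOn_b : ContinuousOn P.b (Icc 0 P.se))
  refine ⟨max (max M₁ M₂) 1, by positivity, fun s hs j => ⟨?_, ?_⟩⟩
  · exact ((norm_le_pi_norm (P.a s) j).trans (h₁ s hs)).trans
      ((le_max_left _ _).trans (le_max_left _ _))
  · exact ((norm_le_pi_norm (P.b s) j).trans (h₂ s hs)).trans
      ((le_max_right _ _).trans (le_max_left _ _))

theorem exists_pos_le {f : Fin m → ℝ} (hf : ∀ j, 0 < f j) : ∃ c > 0, ∀ j, c ≤ f j := by
  rcases isEmpty_or_nonempty (Fin m) with h | h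
  · exact ⟨1, one_pos, fun j => h.elim j⟩
  · obtain ⟨j₀, hj₀⟩ := Finite.exists_min f
    exact ⟨f j₀, hf j₀, hj₀⟩

theorem exists_pos_ge (f : Fin m → ℝ) : ∃ c > 0, ∀ j, f j ≤ c := by
  rcases isEmpty_or_nonempty (Fin m) with h | h
  · exact ⟨1, one_pos, fun j => h.elim j⟩
  · obtain ⟨j₀, hj₀⟩ := Finite.exists_max f
    exact ⟨max (f j₀) 1, by positivity, fun j => (hj₀ j).trans (le_max_left _ _)⟩

end Coefficients

/-! ### Acceleration and velocity limits as extrema over actuators -/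

section Bounds

/-- Of the two stacked rows of an actuator with `a ≠ 0`, exactly one has a positive coefficient; an
actuator with `a = 0` contributes to neither α nor β. -/
theorem β_set_eq (s v : ℝ) :
    {x | ∃ i, 0 < P.A s i ∧ x = (-P.B s i * v ^ 2 - P.C i) / P.A s i} =
      P.accMax s v '' {j | P.a s j ≠ 0} := by
  ext x
  simp only [mem_ofPred_eq, mem_image, Sum.exists, A, B, C, Sum.elim_inl, Sum.elim_inr,
    Pi.neg_apply, accMax]
  constructor
  · rintro (⟨j, hj, rfl⟩ | ⟨j, hj, rfl⟩)
    · refine ⟨j, hj.ne', ?_⟩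
      rw [abs_of_pos hj]
      field_simp
      ring
    · have hj : P.a s j < 0 := by linarith
      refine ⟨j, hj.ne, ?_⟩
      rw [abs_of_neg hj]
      have := hj.ne
      field_simp
      ring
  · rintro ⟨j, hj, rfl⟩
    rcases lt_or_gt_of_ne hj with h | h
    · refine Or.inr ⟨j, by linarith, ?_⟩
      rw [abs_of_neg h]
      field_simp
      ring
    · refine Or.inl ⟨j, h, ?_⟩
      rw [abs_of_pos h]
      field_simp
      ring

theorem α_set_eq (s v : ℝ) :
    {x | ∃ i, P.A s i < 0 ∧ x = (-P.B s i * v ^ 2 - P.C i) / P.A s i} =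
      P.accMin s v '' {j | P.a s j ≠ 0} := by
  ext x
  simp only [mem_ofPred_eq, mem_image, Sum.exists, A, B, C, Sum.elim_inl, Sum.elim_inr,
    Pi.neg_apply, accMin]
  constructor
  · rintro (⟨j, hj, rfl⟩ | ⟨j, hj, rfl⟩)
    · refine ⟨j, hj.ne, ?_⟩
      rw [abs_of_neg hj]
      have := hj.ne
      field_simp
      ring
    · have hj : 0 < P.a s j := by linarith
      refine ⟨j, hj.ne', ?_⟩
      rw [abs_of_pos hj]
      field_simp
      ring
  · rintro ⟨j, hj, rfl⟩
    rcases lt_or_gt_of_ne hj with h | h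
    · refine Or.inl ⟨j, h, ?_⟩
      rw [abs_of_neg h]
      field_simp
      ring
    · refine Or.inr ⟨j, by linarith, ?_⟩
      rw [abs_of_pos h]
      field_simp
      ring

theorem MVCV_set_eq (s : ℝ) :
    {x | ∃ i, 0 < P.A s i ∧ x = -P.D i / P.A s i} =
      (fun j => P.vmax j / |P.a s j|) '' {j | P.a s j ≠ 0} := by
  ext x
  simp only [mem_ofPred_eq, mem_image, Sum.exists, A, D, Sum.elim_inl, Sum.elim_inr,
    Pi.neg_apply, neg_neg]
  constructor
  · rintro (⟨j, hj, rfl⟩ | ⟨j, hj, rfl⟩)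
    · exact ⟨j, hj.ne', by rw [abs_of_pos hj]⟩
    · have hj : P.a s j < 0 := by linarith
      exact ⟨j, hj.ne, by rw [abs_of_neg hj]⟩
  · rintro ⟨j, hj, rfl⟩
    rcases lt_or_gt_of_ne hj with h | h
    · exact Or.inr ⟨j, by linarith, by rw [abs_of_neg h]⟩
    · exact Or.inl ⟨j, h, by rw [abs_of_pos h]⟩

variable {P}

theorem exists_a_ne_zero {s : ℝ} (hs : s ∈ Icc 0 P.se) : {j | P.a s j ≠ 0}.Nonempty := by
  by_contra! h
  refine P.regular s hs (funext fun j => ?_)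
  by_contra hj
  exact (h ▸ hj : j ∈ (∅ : Set (Fin m)))

theorem β_le {s : ℝ} (v : ℝ) {j : Fin m} (hj : P.a s j ≠ 0) : P.β s v ≤ P.accMax s v j := by
  rw [β, β_set_eq]
  exact csInf_le (Set.toFinite _).bddBelow (mem_image_of_mem _ hj)

theorem le_α {s : ℝ} (v : ℝ) {j : Fin m} (hj : P.a s j ≠ 0) : P.accMin s v j ≤ P.α s v := by
  rw [α, α_set_eq]
  exact le_csSup (Set.toFinite _).bddAbove (mem_image_of_mem _ hj)

theorem exists_β_eq {s : ℝ} (hs : s ∈ Icc 0 P.se) (v : ℝ) :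
    ∃ j, P.a s j ≠ 0 ∧ P.β s v = P.accMax s v j := by
  have h := ((exists_a_ne_zero hs).image (P.accMax s v)).csInf_mem (Set.toFinite _)
  rw [β, β_set_eq]
  obtain ⟨j, hj, e⟩ := h
  exact ⟨j, hj, e.symm⟩

theorem exists_α_eq {s : ℝ} (hs : s ∈ Icc 0 P.se) (v : ℝ) :
    ∃ j, P.a s j ≠ 0 ∧ P.α s v = P.accMin s v j := by
  have h := ((exists_a_ne_zero hs).image (P.accMin s v)).csSup_mem (Set.toFinite _)
  rw [α, α_set_eq]
  obtain ⟨j, hj, e⟩ := h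
  exact ⟨j, hj, e.symm⟩

theorem exists_MVCV_eq {s : ℝ} (hs : s ∈ Icc 0 P.se) :
    ∃ j, P.a s j ≠ 0 ∧ P.MVCV s = P.vmax j / |P.a s j| := by
  have h := ((exists_a_ne_zero hs).image fun j => P.vmax j / |P.a s j|).csInf_mem (Set.toFinite _)
  rw [MVCV, MVCV_set_eq]
  obtain ⟨j, hj, e⟩ := h
  exact ⟨j, hj, e.symm⟩

theorem MVCV_le {s : ℝ} {j : Fin m} (hj : P.a s j ≠ 0) : P.MVCV s ≤ P.vmax j / |P.a s j| := by
  rw [MVCV, MVCV_set_eq]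
  exact csInf_le (Set.toFinite _).bddBelow
    (mem_image_of_mem (fun j => P.vmax j / |P.a s j|) hj)

theorem actuatorAcceleration_bounds {s v x : ℝ} {j : Fin m} (hj : P.a s j ≠ 0)
    (h : -P.amax j ≤ P.actuatorAcceleration s v x j ∧
      P.actuatorAcceleration s v x j ≤ P.amax j) :
    P.accMin s v j ≤ x ∧ x ≤ P.accMax s v j := by
  simp only [actuatorAcceleration] at h
  have hx : x = (P.a s j * x + P.b s j * v ^ 2) / P.a s j - P.b s j / P.a s j * v ^ 2 := by
    field_simp
    ring
  have habs : |(P.a s j * x + P.b s j * v ^ 2) / P.a s j| ≤ P.amax j / |P.a s j| := by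
    rw [abs_div]
    gcongr
    exact abs_le.2 h
  obtain ⟨h₁, h₂⟩ := abs_le.1 habs
  simp only [accMin, accMax]
  constructor <;> linarith

end Bounds

/-! ### Uniform estimates for α and β -/

section Uniform

/-- If the bound of an actuator is active at a moderate path acceleration, then the actuator
is far from a zero of `a`, or the bound is decreasing in the path velocity. -/
theorem neg_ratio_le {a b r K M r₀ x : ℝ} (ha : a ≠ 0) (hr₀ : 0 < r₀) (hr : r₀ ≤ r) (hK : 0 < K)
    (hM : 0 < M) (hb : |b| ≤ M) (hx : 0 ≤ x) (h : r / |a| - b / a * x ≤ K) :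
    -(b / a) ≤ M * K / r₀ := by
  rcases le_or_gt 0 (b / a) with h0 | h0
  · have : 0 ≤ M * K / r₀ := by positivity
    linarith
  · have ha' : 0 < |a| := abs_pos.2 ha
    -- For a negative ratio both terms on the left of `h` are nonnegative, so the first alone is at
    -- most `K`; this keeps `|a|` above `r₀ / K`.
    have h1 : r / |a| ≤ K := by nlinarith
    have h2 : r₀ ≤ K * |a| := hr.trans ((div_le_iff₀ ha').1 h1)
    calc -(b / a) ≤ |b / a| := neg_le_abs _
      _ = |b| / |a| := abs_div _ _
      _ ≤ M / |a| := by gcongr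
      _ ≤ M * K / r₀ := by
        rw [div_le_div_iff₀ ha' hr₀, mul_assoc]
        gcongr

/-- An actuator whose coefficient is bounded away from zero already caps β and α. No bounds in the
opposite direction are claimed, as β can be very negative near a zero of another coefficient. -/
theorem exists_acc_bound (V : ℝ) : ∃ K > 0, ∀ s ∈ Icc 0 P.se, ∀ v, 0 ≤ v → v ≤ V →
    P.β s v ≤ K ∧ -K ≤ P.α s v := by
  obtain ⟨c, hc, hac⟩ := P.exists_lower_bound_a
  obtain ⟨M, hM, hab⟩ := P.exists_upper_bound_ab
  obtain ⟨R, hR, hamax⟩ := exists_pos_ge P.amax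
  refine ⟨R / c + M / c * V ^ 2, by positivity, fun s hs v hv hvV => ?_⟩
  obtain ⟨j, hj⟩ := hac s hs
  have hj0 : P.a s j ≠ 0 := abs_pos.1 (hc.trans_le hj)
  have h1 : P.amax j / |P.a s j| ≤ R / c := by
    gcongr
    exact hamax j
  have h2 : |P.b s j / P.a s j * v ^ 2| ≤ M / c * V ^ 2 := by
    rw [abs_mul, abs_div, abs_of_nonneg (sq_nonneg v)]
    have := (hab s hs j).2
    gcongr
  obtain ⟨h3, h4⟩ := abs_le.1 h2
  have h5 := β_le v hj0
  have h6 := le_α v hj0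
  simp only [accMax, accMin] at h5 h6
  constructor <;> linarith

/-- The bounds on the path acceleration are one-sided Lipschitz continuous in the kinetic energy,
even in the neighborhood of zero-inertia points. -/
theorem exists_oneSided_lipschitz (V : ℝ) : ∃ L > 0, ∀ s ∈ Icc 0 P.se, ∀ x y, 0 ≤ x → x ≤ V →
    x ≤ y → P.β s y - P.β s x ≤ L * (y ^ 2 - x ^ 2) ∧
      -(L * (y ^ 2 - x ^ 2)) ≤ P.α s y - P.α s x := by
  obtain ⟨K, hK, hacc⟩ := P.exists_acc_bound V
  obtain ⟨M, hM, hab⟩ := P.exists_upper_bound_ab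
  obtain ⟨r, hr, hamin⟩ := exists_pos_le P.amax_pos
  refine ⟨M * K / r, by positivity, fun s hs x y hx hxV hxy => ?_⟩
  have hsq : 0 ≤ y ^ 2 - x ^ 2 := by nlinarith
  obtain ⟨hβ, hα⟩ := hacc s hs x hx hxV
  constructor
  · obtain ⟨j, hj, e⟩ := exists_β_eq hs x
    -- The actuator active at `x` still bounds β at `y`. In the difference the terms `amax / |a|`
    -- cancel and only `-(b / a) * (y ^ 2 - x ^ 2)` remains.
    have h := β_le y hj
    rw [e] at hβ ⊢
    simp only [accMax] at hβ h ⊢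
    have := neg_ratio_le hj hr (hamin j) hK hM (hab s hs j).2 (sq_nonneg x) hβ
    nlinarith
  · obtain ⟨j, hj, e⟩ := exists_α_eq hs x
    have h := le_α y hj
    rw [e] at hα ⊢
    simp only [accMin] at hα h ⊢
    have := neg_ratio_le (b := -P.b s j) (x := x ^ 2) hj hr (hamin j) hK hM
      (by simpa using (hab s hs j).2) (sq_nonneg x) (by rw [neg_div]; linarith)
    rw [neg_div] at this
    nlinarith

/-- At low velocity the term `b * v ^ 2` uses up at most half of the acceleration bound. This keeps
MVC away from zero and lets profiles leave rest. -/
theorem exists_acc_gap : ∃ c > 0, ∃ y₀ > 0, ∀ s ∈ Icc 0 P.se, ∀ v : ℝ, v ^ 2 ≤ y₀ →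
    c ≤ P.β s v ∧ P.α s v ≤ -c := by
  obtain ⟨M, hM, hab⟩ := P.exists_upper_bound_ab
  obtain ⟨r, hr, hamin⟩ := exists_pos_le P.amax_pos
  have key : ∀ s ∈ Icc 0 P.se, ∀ v : ℝ, v ^ 2 ≤ r / (2 * M) → ∀ j, P.a s j ≠ 0 →
      r / (2 * M) + |P.b s j / P.a s j * v ^ 2| ≤ P.amax j / |P.a s j| := by
    intro s hs v hv j hj
    have hj' : 0 < |P.a s j| := abs_pos.2 hj
    obtain ⟨ha, hb⟩ := hab s hs j
    have h1 : |P.b s j / P.a s j * v ^ 2| ≤ r / 2 / |P.a s j| := by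
      rw [abs_mul, abs_div, abs_of_nonneg (sq_nonneg v), div_mul_eq_mul_div]
      gcongr
      calc |P.b s j| * v ^ 2 ≤ M * (r / (2 * M)) := by gcongr
        _ = r / 2 := by field_simp
    have h2 : r / (2 * M) ≤ r / 2 / |P.a s j| := by
      rw [div_div]
      gcongr
    calc _ ≤ r / 2 / |P.a s j| + r / 2 / |P.a s j| := add_le_add h2 h1
      _ = r / |P.a s j| := by ring
      _ ≤ _ := by
        gcongr
        exact hamin j
  refine ⟨r / (2 * M), by positivity, r / (2 * M), by positivity, fun s hs v hv => ⟨?_, ?_⟩⟩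
  · obtain ⟨j, hj, e⟩ := exists_β_eq hs v
    rw [e, accMax]
    linarith [key s hs v hv j hj, le_abs_self (P.b s j / P.a s j * v ^ 2)]
  · obtain ⟨j, hj, e⟩ := exists_α_eq hs v
    rw [e, accMin]
    linarith [key s hs v hv j hj, neg_le_abs (P.b s j / P.a s j * v ^ 2)]

end Uniform

/-! ### The maximum velocity curve -/

section MVC

variable {P}

theorem MVCV_pos {s : ℝ} (hs : s ∈ Icc 0 P.se) : 0 < P.MVCV s := by
  obtain ⟨j, hj, e⟩ := exists_MVCV_eq hs
  rw [e]
  exact div_pos (P.vmax_pos j) (abs_pos.2 hj)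

theorem MVCA_nonneg (s : ℝ) : 0 ≤ P.MVCA s := by
  refine le_sInf ?_
  rintro _ ⟨v, ⟨hv, -⟩, rfl⟩
  exact EReal.coe_nonneg.2 hv

theorem coe_MVC {s : ℝ} (hs : s ∈ Icc 0 P.se) :
    (P.MVC s : EReal) = min (P.MVCA s) (P.MVCV s : EReal) := by
  refine EReal.coe_toReal (ne_top_of_le_ne_top (EReal.coe_ne_top _) (min_le_right _ _)) ?_
  have : (0 : EReal) ≤ min (P.MVCA s) (P.MVCV s : EReal) :=
    le_min (MVCA_nonneg s) (EReal.coe_nonneg.2 (MVCV_pos hs).le)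
  exact fun h => absurd (h ▸ this) (by simp)

theorem le_MVC_iff {s x : ℝ} (hs : s ∈ Icc 0 P.se) :
    x ≤ P.MVC s ↔ (∀ v, 0 ≤ v → P.α s v = P.β s v → x ≤ v) ∧ x ≤ P.MVCV s := by
  rw [← EReal.coe_le_coe_iff, coe_MVC hs, le_min_iff, EReal.coe_le_coe_iff, MVCA, le_sInf_iff]
  refine and_congr_left fun _ => ⟨fun h v hv e => ?_, ?_⟩
  · exact EReal.coe_le_coe_iff.1 (h _ ⟨v, ⟨hv, e⟩, rfl⟩)
  · rintro h _ ⟨v, ⟨hv, e⟩, rfl⟩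
    exact EReal.coe_le_coe_iff.2 (h v hv e)

variable (P)

/-- Boundedness makes the real `sSup` in `maxMVC` a true supremum instead of the default value 0. -/
theorem bddAbove_MVC : BddAbove (P.MVC '' Icc 0 P.se) := by
  obtain ⟨c, hc, hac⟩ := P.exists_lower_bound_a
  obtain ⟨R, hR, hvmax⟩ := exists_pos_ge P.vmax
  refine ⟨R / c, ?_⟩
  rintro _ ⟨s, hs, rfl⟩
  obtain ⟨j, hj⟩ := hac s hs
  refine (((le_MVC_iff hs).1 le_rfl).2.trans (MVCV_le (abs_pos.1 (hc.trans_le hj)))).trans ?_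
  gcongr
  exact hvmax j

theorem exists_pos_le_MVC : ∃ μ > 0, ∀ s ∈ Icc 0 P.se, μ ≤ P.MVC s := by
  obtain ⟨M, hM, hab⟩ := P.exists_upper_bound_ab
  obtain ⟨r, hr, hvmin⟩ := exists_pos_le P.vmax_pos
  obtain ⟨c, hc, y₀, hy₀, hgap⟩ := P.exists_acc_gap
  refine ⟨min (√y₀) (r / M), by positivity, fun s hs => (le_MVC_iff hs).2 ⟨fun v hv e => ?_, ?_⟩⟩
  · refine (min_le_left _ _).trans ?_
    by_contra! h
    obtain ⟨h1, h2⟩ := hgap s hs v ((Real.le_sqrt hv hy₀.le).1 h.le)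
    linarith
  · refine (min_le_right _ _).trans ?_
    obtain ⟨j, hj, e⟩ := exists_MVCV_eq hs
    have := abs_pos.2 hj
    rw [e]
    exact div_le_div₀ (P.vmax_pos j).le (hvmin j) this (hab s hs j).1

theorem MVCstar_maxMVC {s : ℝ} (hs : s ∈ Icc 0 P.se) : P.MVCstar P.maxMVC s = P.MVC s :=
  min_eq_left (le_csSup P.bddAbove_MVC (mem_image_of_mem _ hs))

end MVC

end PathProblem

/-! ### Gronwall-type comparison in integrated form -/

section Comparison

/-- A continuous function which starts nonpositive and whose growth where it is positive is at most
proportional to its size stays nonpositive. -/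
theorem nonpos_of_growth_forward {d : ℝ → ℝ} {p q L : ℝ} (hL : 0 < L)
    (hd : ContinuousOn d (Icc p q)) (hp : d p ≤ 0)
    (H : ∀ r s D, p ≤ r → r ≤ s → s ≤ q → (∀ x ∈ Ioo r s, 0 < d x ∧ d x ≤ D) →
      d s - d r ≤ L * D * (s - r)) : ∀ x ∈ Icc p q, d x ≤ 0 := by
  intro x hx
  by_contra! hpos
  have hsub : Icc p x ⊆ Icc p q := Icc_subset_Icc_right hx.2
  have hcl : IsCompact (Icc p x ∩ d ⁻¹' Iic 0) :=
    isCompact_Icc.of_isClosed_subset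
      ((hd.mono hsub).preimage_isClosed_of_isClosed isClosed_Icc isClosed_Iic) inter_subset_left
  -- `r` is the last point up to `x` at which `d` is nonpositive.
  obtain ⟨r, ⟨hr, hdr⟩, hmax⟩ := hcl.exists_isGreatest ⟨p, ⟨le_rfl, hx.1⟩, hp⟩
  have hdr : d r ≤ 0 := hdr
  have hrx : r < x := lt_of_le_of_ne hr.2 fun h => by rw [h] at hdr; linarith
  have hafter : ∀ z, r < z → z ≤ x → 0 < d z := fun z h1 h2 => by
    by_contra! h
    exact absurd (hmax ⟨⟨hr.1.trans h1.le, h2⟩, h⟩) (not_le.2 h1)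
  -- On a stretch of length at most `1 / (2 * L)` the growth from `r` is at most half of the maximum
  -- of `d`; hence that positive maximum is at most half of itself.
  set e := min x (r + 1 / (2 * L)) with he
  have hre : r < e := lt_min hrx (by simpa using by positivity)
  have hex : e ≤ x := min_le_left _ _
  obtain ⟨s, hs, hsmax⟩ := isCompact_Icc.exists_isMaxOn (nonempty_Icc.2 hre.le)
    ((hd.mono hsub).mono (Icc_subset_Icc hr.1 hex))
  have hsmax : ∀ z ∈ Icc r e, d z ≤ d s := hsmax
  have hds : 0 < d s := (hafter e hre hex).trans_le (hsmax e ⟨hre.le, le_rfl⟩)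
  have h1 := H r s (d s) hr.1 hs.1 ((hs.2.trans hex).trans hx.2) fun z hz =>
    ⟨hafter z hz.1 (hz.2.le.trans (hs.2.trans hex)), hsmax z ⟨hz.1.le, hz.2.le.trans hs.2⟩⟩
  have h2 : s - r ≤ 1 / (2 * L) := by linarith [hs.2.trans (min_le_right x (r + 1 / (2 * L)))]
  have h3 : L * d s * (s - r) ≤ L * d s * (1 / (2 * L)) := by gcongr
  have h4 : L * d s * (1 / (2 * L)) = d s / 2 := by field_simp
  linarith

theorem nonpos_of_growth_backward {d : ℝ → ℝ} {p q L : ℝ} (hL : 0 < L)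
    (hd : ContinuousOn d (Icc p q)) (hq : d q ≤ 0)
    (H : ∀ r s D, p ≤ r → r ≤ s → s ≤ q → (∀ x ∈ Ioo r s, 0 < d x ∧ d x ≤ D) →
      d r - d s ≤ L * D * (s - r)) : ∀ x ∈ Icc p q, d x ≤ 0 := by
  intro x hx
  have := nonpos_of_growth_forward (d := fun z => d (-z)) (p := -q) (q := -p) hL
    (hd.comp continuous_neg.continuousOn fun z hz => ⟨by linarith [hz.2], by linarith [hz.1]⟩)
    (by simpa using hq)
    (fun r s D h1 h2 h3 h => by
      have := H (-s) (-r) D (by linarith) (by linarith) (by linarith) fun z hz => by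
        simpa using h (-z) ⟨by linarith [hz.2], by linarith [hz.1]⟩
      linarith)
    (-x) ⟨by linarith [hx.2], by linarith [hx.1]⟩
  simpa using this

theorem integral_le_const_mul {f : ℝ → ℝ} {r s C : ℝ} (hrs : r ≤ s)
    (hf : IntervalIntegrable f volume r s) (h : ∀ᵐ x, x ∈ Ioo r s → f x ≤ C) :
    ∫ x in r..s, f x ≤ C * (s - r) := by
  have := intervalIntegral.integral_mono_ae_restrict hrs hf
    (intervalIntegrable_const (c := C)) (by
      rw [← restrict_Ioo_eq_restrict_Icc]
      exact (ae_restrict_iff' measurableSet_Ioo).2 h)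
  simpa [mul_comm] using this

theorem const_mul_le_integral {f : ℝ → ℝ} {r s C : ℝ} (hrs : r ≤ s)
    (hf : IntervalIntegrable f volume r s) (h : ∀ᵐ x, x ∈ Ioo r s → C ≤ f x) :
    C * (s - r) ≤ ∫ x in r..s, f x := by
  have := integral_le_const_mul (C := -C) hrs hf.neg
    (h.mono fun x hx hxI => neg_le_neg (hx hxI))
  simp only [Pi.neg_apply, intervalIntegral.integral_neg] at this
  linarith

end Comparison

/-- A property that holds almost everywhere on a nondegenerate interval holds frequently near each
of its points. -/
theorem frequently_nhdsWithin_of_ae {p q : ℝ} (hpq : p < q) {φ : ℝ → Prop}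
    (h : ∀ᵐ x, x ∈ Icc p q → φ x) {s : ℝ} (hs : s ∈ Icc p q) : ∃ᶠ x in 𝓝[Icc p q] s, φ x := by
  intro hn
  obtain ⟨U, hU, hsU, hUn⟩ := mem_nhdsWithin.1 hn
  have hne : (U ∩ Ioo p q).Nonempty := by
    rw [← closure_Ioo hpq.ne] at hs
    exact mem_closure_iff.1 hs U hU hsU
  refine ((hU.inter isOpen_Ioo).measure_pos volume hne).ne' (measure_mono_null ?_ h)
  intro x hx hφ
  exact hUn ⟨hx.1, Ioo_subset_Icc_self hx.2⟩ (hφ (Ioo_subset_Icc_self hx.2))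

namespace PathProblem

variable {m n : ℕ} {P : PathProblem m n}

/-! ### Admissible trajectories -/

section Profiles

variable {Γ : Profile}

theorem IsProfile.intervalIntegrable (hΓ : P.IsProfile Γ) {r s : ℝ} (hr : r ∈ Icc 0 P.se)
    (hs : s ∈ Icc 0 P.se) : IntervalIntegrable Γ.acc volume r s := by
  refine hΓ.integrable.mono_set ?_
  rw [uIcc_of_le P.se_pos.le]
  exact uIcc_subset_Icc hr hs

theorem IsProfile.sq_sub_sq (hΓ : P.IsProfile Γ) {r s : ℝ} (hr : r ∈ Icc 0 P.se)
    (hs : s ∈ Icc 0 P.se) : Γ.v s ^ 2 - Γ.v r ^ 2 = 2 * ∫ x in r..s, Γ.acc x := by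
  have h0 : (0 : ℝ) ∈ Icc 0 P.se := ⟨le_rfl, P.se_pos.le⟩
  have h := intervalIntegral.integral_interval_sub_left (hΓ.intervalIntegrable h0 hs)
    (hΓ.intervalIntegrable h0 hr)
  linarith [hΓ.energy r hr, hΓ.energy s hs]

theorem IsProfile.continuousOn_sq (hΓ : P.IsProfile Γ) :
    ContinuousOn (fun s => Γ.v s ^ 2) (Icc 0 P.se) := by
  have h : ContinuousOn (fun s => ∫ x in (0 : ℝ)..s, Γ.acc x) (Icc 0 P.se) := by
    have := intervalIntegral.continuousOn_primitive_interval' hΓ.integrable left_mem_uIcc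
    rwa [uIcc_of_le P.se_pos.le] at this
  refine ((h.const_mul 2).const_add (P.v0 ^ 2)).congr fun s hs => ?_
  have := hΓ.energy s hs
  simp only
  linarith

theorem IsProfile.continuousOn (hΓ : P.IsProfile Γ) : ContinuousOn Γ.v (Icc 0 P.se) :=
  hΓ.continuousOn_sq.sqrt.congr fun s hs => (Real.sqrt_sq (hΓ.nonneg s hs)).symm

theorem IsAdmissible.acc_bounds (hΓ : P.IsAdmissible Γ) :
    ∀ᵐ s, s ∈ Icc 0 P.se → ∀ j, P.a s j ≠ 0 →
      P.accMin s (Γ.v s) j ≤ Γ.acc s ∧ Γ.acc s ≤ P.accMax s (Γ.v s) j :=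
  ((ae_restrict_iff' measurableSet_Icc).1 hΓ.acceleration).mono fun _ h hs j hj =>
    actuatorAcceleration_bounds hj (h hs j)

theorem IsAdmissible.acc_mem (hΓ : P.IsAdmissible Γ) :
    ∀ᵐ s, s ∈ Icc 0 P.se → P.α s (Γ.v s) ≤ Γ.acc s ∧ Γ.acc s ≤ P.β s (Γ.v s) := by
  filter_upwards [hΓ.acc_bounds] with s h hs
  constructor
  · obtain ⟨j, hj, e⟩ := exists_α_eq hs (Γ.v s)
    exact e ▸ (h hs j hj).1
  · obtain ⟨j, hj, e⟩ := exists_β_eq hs (Γ.v s)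
    exact e ▸ (h hs j hj).2

/-- Almost everywhere the acceleration lies between the two bounds. A strict violation at `s` would
persist nearby, since the bounds of single actuators are continuous where their coefficients do not
vanish; α and β themselves need not be. -/
theorem IsAdmissible.accMin_le_accMax (hΓ : P.IsAdmissible Γ) {s : ℝ} (hs : s ∈ Icc 0 P.se)
    {i j : Fin m} (hi : P.a s i ≠ 0) (hj : P.a s j ≠ 0) :
    P.accMin s (Γ.v s) i ≤ P.accMax s (Γ.v s) j := by
  by_contra! hlt
  have hsq := hΓ.continuousOn_sq s hs
  have hai := P.continuousOn_a i s hs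
  have haj := P.continuousOn_a j s hs
  have hmin : ContinuousWithinAt (fun σ => P.accMin σ (Γ.v σ) i) (Icc 0 P.se) s :=
    (continuousWithinAt_const.div hai.abs (abs_ne_zero.2 hi)).neg.sub
      (((P.continuousOn_b i s hs).div hai hi).mul hsq)
  have hmax : ContinuousWithinAt (fun σ => P.accMax σ (Γ.v σ) j) (Icc 0 P.se) s :=
    (continuousWithinAt_const.div haj.abs (abs_ne_zero.2 hj)).sub
      (((P.continuousOn_b j s hs).div haj hj).mul hsq)
  have hev := (hmax.eventually_lt hmin hlt).and
    ((hai.eventually_ne hi).and (haj.eventually_ne hj))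
  have hfr := frequently_nhdsWithin_of_ae P.se_pos
    (φ := fun σ => σ ∈ Icc 0 P.se → ∀ j, P.a σ j ≠ 0 →
      P.accMin σ (Γ.v σ) j ≤ Γ.acc σ ∧ Γ.acc σ ≤ P.accMax σ (Γ.v σ) j)
    (hΓ.acc_bounds.mono fun _ h _ => h) hs
  obtain ⟨σ, h, ⟨h1, h2, h3⟩, hσ⟩ := (hfr.and_eventually
    (hev.and self_mem_nhdsWithin)).exists
  linarith [(h hσ i h2).1, (h hσ j h3).2]

/-- Admissible trajectories stay under the maximum velocity curve. -/
theorem IsAdmissible.le_MVC (hΓ : P.IsAdmissible Γ) {s : ℝ} (hs : s ∈ Icc 0 P.se) :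
    Γ.v s ≤ P.MVC s := by
  refine (le_MVC_iff hs).2 ⟨fun w hw e => ?_, ?_⟩
  · by_contra! hlt
    obtain ⟨i, hi, ei⟩ := exists_α_eq hs w
    obtain ⟨j, hj, ej⟩ := exists_β_eq hs w
    have h := hΓ.accMin_le_accMax hs hi hj
    rw [ei, ej] at e
    simp only [accMin, accMax] at h e
    have hri : 0 < P.amax i / |P.a s i| := div_pos (P.amax_pos i) (abs_pos.2 hi)
    have hrj : 0 < P.amax j / |P.a s j| := div_pos (P.amax_pos j) (abs_pos.2 hj)
    -- The gap between the bounds of `j` and `i` is a positive constant minus `u * v ^ 2`. It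
    -- vanishes at `w`, so `u > 0` and the gap is negative at every larger velocity.
    set u := P.b s j / P.a s j - P.b s i / P.a s i with hu
    have h1 : u * w ^ 2 = P.amax i / |P.a s i| + P.amax j / |P.a s j| := by rw [hu]; linarith
    have h2 : u * Γ.v s ^ 2 ≤ P.amax i / |P.a s i| + P.amax j / |P.a s j| := by rw [hu]; linarith
    have hu0 : 0 < u := pos_of_mul_pos_left (h1 ▸ add_pos hri hrj) (sq_nonneg w)
    have h3 : w ^ 2 < Γ.v s ^ 2 := by gcongr
    nlinarith
  · obtain ⟨j, hj, e⟩ := exists_MVCV_eq hs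
    have hv := hΓ.velocity s hs j
    simp only [actuatorVelocity] at hv
    rw [e, le_div_iff₀ (abs_pos.2 hj), mul_comm, ← abs_of_nonneg (hΓ.nonneg s hs), ← abs_mul]
    exact abs_le.2 hv

theorem IsAdmissible.isFeasibleUnder_maxMVC (hΓ : P.IsAdmissible Γ) :
    P.IsFeasibleUnder P.maxMVC Γ :=
  ⟨hΓ, fun _ hs => (P.MVCstar_maxMVC hs).symm ▸ hΓ.le_MVC hs⟩

theorem IsFeasibleUnder.le_param {ε : ℝ} (hΓ : P.IsFeasibleUnder ε Γ) {s : ℝ}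
    (hs : s ∈ Icc 0 P.se) : Γ.v s ≤ ε :=
  (hΓ.under s hs).trans (min_le_right _ _)

theorem IsFeasibleUnder.mono {ε₁ ε₂ : ℝ} (hΓ : P.IsFeasibleUnder ε₂ Γ) (h : ε₂ ≤ ε₁) :
    P.IsFeasibleUnder ε₁ Γ :=
  ⟨hΓ.toIsAdmissible, fun s hs => (hΓ.under s hs).trans (min_le_min_left _ h)⟩

variable (P) in
theorem exists_energy_lipschitz (ε : ℝ) : ∃ K > 0, ∀ Γ, P.IsFeasibleUnder ε Γ →
    ∀ r ∈ Icc 0 P.se, ∀ s ∈ Icc 0 P.se, r ≤ s → |Γ.v s ^ 2 - Γ.v r ^ 2| ≤ K * (s - r) := by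
  obtain ⟨K, hK, hacc⟩ := P.exists_acc_bound ε
  refine ⟨2 * K, by positivity, fun Γ hΓ r hr s hs hrs => ?_⟩
  have hi := hΓ.intervalIntegrable hr hs
  have hmem : ∀ x ∈ Ioo r s, x ∈ Icc 0 P.se := fun x hx =>
    ⟨hr.1.trans hx.1.le, hx.2.le.trans hs.2⟩
  have hb : ∀ᵐ x, x ∈ Ioo r s → -K ≤ Γ.acc x ∧ Γ.acc x ≤ K := by
    filter_upwards [hΓ.toIsAdmissible.acc_mem] with x h hx
    have hx := hmem x hx
    obtain ⟨h1, h2⟩ := hacc x hx _ (hΓ.nonneg x hx) (hΓ.le_param hx)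
    exact ⟨h2.trans (h hx).1, (h hx).2.trans h1⟩
  have h1 := integral_le_const_mul hrs hi (hb.mono fun x h hx => (h hx).2)
  have h2 := const_mul_le_integral hrs hi (hb.mono fun x h hx => (h hx).1)
  rw [hΓ.sq_sub_sq hr hs, abs_le]
  constructor <;> linarith

end Profiles

end PathProblem

namespace PathProblem

variable {m n : ℕ} {P : PathProblem m n} {ε : ℝ}

/-! ### Maximality and positivity of CNI trajectories -/

namespace CNITrajectory

variable (Ω : P.CNITrajectory ε)

theorem t_le_t {i j : ℕ} (hij : i ≤ j) (hj : j ≤ Ω.N) : Ω.t i ≤ Ω.t j := by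
  induction j, hij using Nat.le_induction with
  | base => exact le_rfl
  | succ k _ ih => exact (ih (by omega)).trans (Ω.t_lt k (by omega)).le

theorem t_mem {k : ℕ} (hk : k ≤ Ω.N) : Ω.t k ∈ Icc 0 P.se :=
  ⟨Ω.t_zero ▸ Ω.t_le_t k.zero_le hk, Ω.t_last ▸ Ω.t_le_t hk le_rfl⟩

theorem piece_subset {k : ℕ} (hk : k < Ω.N) : Icc (Ω.t k) (Ω.t (k + 1)) ⊆ Icc 0 P.se :=
  Icc_subset_Icc (Ω.t_mem hk.le).1 (Ω.t_mem hk).2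

theorem exists_piece {s : ℝ} (hs : s ∈ Icc 0 P.se) :
    ∃ k < Ω.N, s ∈ Icc (Ω.t k) (Ω.t (k + 1)) := by
  have key : ∀ N ≤ Ω.N, 0 < N → ∀ s ∈ Icc (Ω.t 0) (Ω.t N),
      ∃ k < N, s ∈ Icc (Ω.t k) (Ω.t (k + 1)) := by
    intro N
    induction N with
    | zero => exact fun _ h => absurd h (lt_irrefl 0)
    | succ N ih =>
      intro hN _ s hs
      rcases le_total (Ω.t N) s with h | h
      · exact ⟨N, N.lt_succ_self, h, hs.2⟩
      · rcases N.eq_zero_or_pos with rfl | hpos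
        · exact ⟨0, one_pos, hs⟩
        · obtain ⟨k, hk, hsk⟩ := ih (by omega) hpos s ⟨hs.1, h⟩
          exact ⟨k, by omega, hsk⟩
  have hN : 0 < Ω.N := by
    by_contra! h
    have h0 : Ω.N = 0 := by omega
    have := Ω.t_last
    rw [h0, Ω.t_zero] at this
    exact P.se_pos.ne this
  exact key Ω.N le_rfl hN s (by rwa [Ω.t_zero, Ω.t_last])

theorem continuousOn : ContinuousOn Ω.v (Icc 0 P.se) := Ω.feasible.continuousOn

/-- An admissible trajectory that respects the part of `MVC*` below the level `η` stays below a
trajectory of complete numerical integration whose velocities are less than `η`. -/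
theorem le_of_under {Γ : Profile} (hΓ : P.IsAdmissible Γ) {η : ℝ}
    (hη : ∀ s ∈ Icc 0 P.se, Ω.v s < η)
    (H : ∀ s ∈ Icc 0 P.se, P.MVCstar ε s < η → Γ.v s ≤ P.MVCstar ε s) :
    ∀ s ∈ Icc 0 P.se, Γ.v s ≤ Ω.v s := by
  obtain ⟨L, hL, hlip⟩ := P.exists_oneSided_lipschitz ε
  have hΩ := Ω.feasible
  have hd : ContinuousOn (fun s => Γ.v s ^ 2 - Ω.v s ^ 2) (Icc 0 P.se) :=
    hΓ.continuousOn_sq.sub hΩ.continuousOn_sq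
  have hle : ∀ s ∈ Icc 0 P.se, Γ.v s ^ 2 - Ω.v s ^ 2 ≤ 0 ↔ Γ.v s ≤ Ω.v s := fun s hs => by
    rw [sub_nonpos, sq_le_sq₀ (hΓ.nonneg s hs) (hΩ.nonneg s hs)]
  have hlt : ∀ s ∈ Icc 0 P.se, 0 < Γ.v s ^ 2 - Ω.v s ^ 2 → Ω.v s ≤ Γ.v s := fun s hs h => by
    by_contra! hc
    exact absurd ((hle s hs).2 hc.le) (not_le.2 h)
  -- Graph points approximating a point of the closure eventually lie below `η`, where `H` bounds
  -- `Γ`; continuity of `Γ` passes this to the limit.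
  have hcurve : ∀ s ∈ Icc 0 P.se, P.OnMVCstar ε s (Ω.v s) → Γ.v s ≤ Ω.v s := by
    intro s hs h
    obtain ⟨u, hu, hlim⟩ := mem_closure_iff_seq_limit.1 h
    choose σ hσ e using hu
    have h1 : Tendsto σ atTop (𝓝 s) := by
      have := (continuous_fst.tendsto _).comp hlim
      exact this.congr fun k => by simp [← e k]
    have h2 : Tendsto (fun k => P.MVCstar ε (σ k)) atTop (𝓝 (Ω.v s)) := by
      have := (continuous_snd.tendsto _).comp hlim
      exact this.congr fun k => by simp [← e k]
    have h3 : Tendsto (fun k => Γ.v (σ k)) atTop (𝓝 (Γ.v s)) :=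
      (hΓ.continuousOn s hs).tendsto.comp
        (tendsto_nhdsWithin_iff.2 ⟨h1, Eventually.of_forall hσ⟩)
    exact le_of_tendsto_of_tendsto h3 h2
      ((h2.eventually_lt_const (hη s hs)).mono fun k hk => H _ (hσ k) hk)
  have hsub : ∀ r s, r ∈ Icc 0 P.se → s ∈ Icc 0 P.se →
      (Γ.v s ^ 2 - Ω.v s ^ 2) - (Γ.v r ^ 2 - Ω.v r ^ 2) =
        2 * ∫ x in r..s, (Γ.acc x - Ω.acc x) := by
    intro r s hr hs
    rw [intervalIntegral.integral_sub (hΓ.intervalIntegrable hr hs)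
      (hΩ.intervalIntegrable hr hs)]
    linarith [hΓ.sq_sub_sq hr hs, hΩ.sq_sub_sq hr hs]
  intro s hs
  obtain ⟨k, hk, hsk⟩ := Ω.exists_piece hs
  have hpiece := Ω.piece_subset hk
  have hlt_t := Ω.t_lt k hk
  cases hkind : Ω.kind k with
  | accel =>
    obtain ⟨hacc, hstart⟩ := Ω.accel_piece k hk hkind
    have hmem := hpiece (left_mem_Icc.2 hlt_t.le)
    refine (hle s hs).1 (nonpos_of_growth_forward (mul_pos two_pos hL) (hd.mono hpiece) ?_ ?_ s hsk)
    · rw [hle _ hmem]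
      rcases hstart with h | h
      · rw [h, hΓ.start, hΩ.start]
      · exact hcurve _ hmem h
    · intro r q D hr hrq hq hD
      have hr' := hpiece ⟨hr, hrq.trans hq⟩
      have hq' := hpiece ⟨hr.trans hrq, hq⟩
      rw [hsub r q hr' hq', mul_assoc, mul_assoc, ← mul_assoc L]
      refine mul_le_mul_of_nonneg_left (integral_le_const_mul hrq
        ((hΓ.intervalIntegrable hr' hq').sub (hΩ.intervalIntegrable hr' hq')) ?_) two_pos.le
      -- `Γ` accelerates by at most β at its own velocity, and where it is faster than `Ω` this
      -- exceeds β at the velocity of `Ω` by at most `L * D`.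
      filter_upwards [(ae_restrict_iff' measurableSet_Icc).1 hacc, hΓ.acc_mem] with x h1 h2 hx
      have hxk : x ∈ Icc (Ω.t k) (Ω.t (k + 1)) := ⟨hr.trans hx.1.le, hx.2.le.trans hq⟩
      have hx' := hpiece hxk
      obtain ⟨h3, h4⟩ := hD x hx
      have h5 := (hlip x hx' _ _ (hΩ.nonneg x hx') (hΩ.le_param hx') (hlt x hx' h3)).1
      have h6 := mul_le_mul_of_nonneg_left h4 hL.le
      rw [h1 hxk]
      linarith [(h2 hx').2]
  | decel =>
    obtain ⟨hacc, hend⟩ := Ω.decel_piece k hk hkind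
    have hmem := hpiece (right_mem_Icc.2 hlt_t.le)
    refine (hle s hs).1
      (nonpos_of_growth_backward (mul_pos two_pos hL) (hd.mono hpiece) ?_ ?_ s hsk)
    · rw [hle _ hmem]
      rcases hend with h | h
      · rw [h, hΓ.terminal, hΩ.terminal]
      · exact hcurve _ hmem h
    · intro r q D hr hrq hq hD
      have hr' := hpiece ⟨hr, hrq.trans hq⟩
      have hq' := hpiece ⟨hr.trans hrq, hq⟩
      have hint : -(L * D) * (q - r) ≤ ∫ x in r..q, (Γ.acc x - Ω.acc x) := by
        refine const_mul_le_integral hrq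
          ((hΓ.intervalIntegrable hr' hq').sub (hΩ.intervalIntegrable hr' hq')) ?_
        filter_upwards [(ae_restrict_iff' measurableSet_Icc).1 hacc, hΓ.acc_mem] with x h1 h2 hx
        have hxk : x ∈ Icc (Ω.t k) (Ω.t (k + 1)) := ⟨hr.trans hx.1.le, hx.2.le.trans hq⟩
        have hx' := hpiece hxk
        obtain ⟨h3, h4⟩ := hD x hx
        have h5 := (hlip x hx' _ _ (hΩ.nonneg x hx') (hΩ.le_param hx') (hlt x hx' h3)).2
        have h6 := mul_le_mul_of_nonneg_left h4 hL.le
        rw [h1 hxk]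
        linarith [(h2 hx').1]
      linarith [hsub r q hr' hq']
  | switchArc =>
    have harc := Ω.switchArc_piece k hk hkind
    have hcl : closure (Ioo (Ω.t k) (Ω.t (k + 1))) = Icc (Ω.t k) (Ω.t (k + 1)) :=
      closure_Ioo hlt_t.ne
    refine le_on_closure (fun x hx => ?_) (hcl ▸ hΓ.continuousOn.mono hpiece)
      (hcl ▸ Ω.continuousOn.mono hpiece) (hcl ▸ hsk)
    have hx' := hpiece (Ioo_subset_Icc_self hx)
    have := hη x hx'
    rw [harc x hx] at this ⊢
    exact H x hx' this

theorem le_of_feasible {Γ : Profile} (hΓ : P.IsFeasibleUnder ε Γ) :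
    ∀ s ∈ Icc 0 P.se, Γ.v s ≤ Ω.v s :=
  Ω.le_of_under (η := ε + 1) hΓ.toIsAdmissible
    (fun _ hs => (Ω.feasible.le_param hs).trans_lt (lt_add_one ε)) fun s hs _ => hΓ.under s hs

/-- A level line that `Ω` never reaches does not restrict the comparison: the part of `MVC*`
strictly below it is MVC, which every admissible trajectory respects. -/
theorem le_of_admissible_of_lt {Γ : Profile} (hΓ : P.IsAdmissible Γ)
    (hlt : ∀ s ∈ Icc 0 P.se, Ω.v s < ε) : ∀ s ∈ Icc 0 P.se, Γ.v s ≤ Ω.v s := by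
  refine Ω.le_of_under hΓ hlt fun s hs h => ?_
  have hM : P.MVC s < ε := by
    by_contra! hc
    rw [MVCstar, min_eq_right hc] at h
    exact lt_irrefl _ h
  rw [MVCstar, min_eq_left hM.le]
  exact hΓ.le_MVC hs

/-- The kinetic energy grows at least linearly with the distance from the ends of the path. -/
theorem exists_energy_lower_bound (hε : 0 < ε) :
    ∃ κ > 0, ∀ s ∈ Icc 0 P.se, κ * s ≤ Ω.v s ^ 2 ∨ κ * (P.se - s) ≤ Ω.v s ^ 2 := by
  obtain ⟨μ, hμ, hMVC⟩ := P.exists_pos_le_MVC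
  obtain ⟨c, hc, y₀, hy₀, hgap⟩ := P.exists_acc_gap
  have hΩ := Ω.feasible
  have hse := P.se_pos
  set ν := min μ ε
  have hν : 0 < ν := lt_min hμ hε
  have hstar : ∀ s ∈ Icc 0 P.se, ν ≤ P.MVCstar ε s := fun s hs => min_le_min_right _ (hMVC s hs)
  have hcurve : ∀ s x, P.OnMVCstar ε s x → ν ≤ x := by
    intro s x h
    have : (s, x) ∈ {z : ℝ × ℝ | ν ≤ z.2} := by
      refine closure_minimal ?_ (isClosed_le continuous_const continuous_snd) h
      rintro _ ⟨σ, hσ, rfl⟩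
      exact hstar σ hσ
    exact this
  -- `κ ≤ 2 * c` makes v² at least as steep as the comparison line at low velocity; `κ * P.se ≤ y₀`
  -- puts every point below the line into that regime; `κ * P.se ≤ ν ^ 2` puts every point of the
  -- curve above the line.
  obtain ⟨κ, hκ, hκc, hκy, hκν⟩ : ∃ κ > 0, κ ≤ 2 * c ∧ κ * P.se ≤ y₀ ∧ κ * P.se ≤ ν ^ 2 := by
    refine ⟨min (2 * c) (min (y₀ / P.se) (ν ^ 2 / P.se)), by positivity, min_le_left _ _, ?_, ?_⟩
    · rw [← le_div_iff₀ hse]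
      exact (min_le_right _ _).trans (min_le_left _ _)
    · rw [← le_div_iff₀ hse]
      exact (min_le_right _ _).trans (min_le_right _ _)
  refine ⟨κ, hκ, fun s hs => ?_⟩
  obtain ⟨k, hk, hsk⟩ := Ω.exists_piece hs
  have hpiece := Ω.piece_subset hk
  have hlt_t := Ω.t_lt k hk
  have hcsq := hΩ.continuousOn_sq.mono hpiece
  cases hkind : Ω.kind k with
  | accel =>
    obtain ⟨hacc, hstart⟩ := Ω.accel_piece k hk hkind
    have hmem := hpiece (left_mem_Icc.2 hlt_t.le)
    left
    -- The growth constant 1 is arbitrary, since the difference does not increase at all where it is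
    -- positive.
    have := nonpos_of_growth_forward (d := fun s => κ * s - Ω.v s ^ 2) one_pos
      ((continuous_const_mul κ).continuousOn.sub hcsq) ?_ ?_ s hsk
    · simpa using this
    · rcases hstart with h | h
      · simpa [h] using sq_nonneg _
      · have h1 := pow_le_pow_left₀ hν.le (hcurve _ _ h) 2
        have h2 := mul_le_mul_of_nonneg_left hmem.2 hκ.le
        linarith
    · intro r q D hr hrq hq hD
      have hr' := hpiece ⟨hr, hrq.trans hq⟩
      have hq' := hpiece ⟨hr.trans hrq, hq⟩
      have hint : c * (q - r) ≤ ∫ x in r..q, Ω.acc x := by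
        refine const_mul_le_integral hrq (hΩ.intervalIntegrable hr' hq') ?_
        filter_upwards [(ae_restrict_iff' measurableSet_Icc).1 hacc] with x h1 hx
        have hxk : x ∈ Icc (Ω.t k) (Ω.t (k + 1)) := ⟨hr.trans hx.1.le, hx.2.le.trans hq⟩
        have hx' := hpiece hxk
        have h2 := mul_le_mul_of_nonneg_left hx'.2 hκ.le
        rw [h1 hxk]
        exact (hgap x hx' _ (by linarith [(hD x hx).1])).1
      have h3 := hΩ.sq_sub_sq hr' hq'
      have h4 : 0 ≤ (2 * c - κ) * (q - r) := mul_nonneg (by linarith) (by linarith)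
      have h5 : 0 ≤ D * (q - r) := by
        rcases hrq.eq_or_lt with rfl | hlt
        · simp
        · obtain ⟨x, hx⟩ := nonempty_Ioo.2 hlt
          exact mul_nonneg ((hD x hx).1.le.trans (hD x hx).2) (by linarith)
      linarith
  | decel =>
    obtain ⟨hacc, hend⟩ := Ω.decel_piece k hk hkind
    have hmem := hpiece (right_mem_Icc.2 hlt_t.le)
    right
    have := nonpos_of_growth_backward (d := fun s => κ * (P.se - s) - Ω.v s ^ 2) one_pos
      ((continuous_const.mul (continuous_const.sub continuous_id)).continuousOn.sub hcsq) ?_ ?_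
      s hsk
    · simpa using this
    · rcases hend with h | h
      · simpa [h] using sq_nonneg _
      · have h1 := pow_le_pow_left₀ hν.le (hcurve _ _ h) 2
        have h2 := mul_nonneg hκ.le hmem.1
        linarith
    · intro r q D hr hrq hq hD
      have hr' := hpiece ⟨hr, hrq.trans hq⟩
      have hq' := hpiece ⟨hr.trans hrq, hq⟩
      have hint : ∫ x in r..q, Ω.acc x ≤ -c * (q - r) := by
        refine integral_le_const_mul hrq (hΩ.intervalIntegrable hr' hq') ?_
        filter_upwards [(ae_restrict_iff' measurableSet_Icc).1 hacc] with x h1 hx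
        have hxk : x ∈ Icc (Ω.t k) (Ω.t (k + 1)) := ⟨hr.trans hx.1.le, hx.2.le.trans hq⟩
        have hx' := hpiece hxk
        have h2 := mul_nonneg hκ.le hx'.1
        rw [h1 hxk]
        exact (hgap x hx' _ (by linarith [(hD x hx).1])).2
      have h3 := hΩ.sq_sub_sq hr' hq'
      have h4 : 0 ≤ (2 * c - κ) * (q - r) := mul_nonneg (by linarith) (by linarith)
      have h5 : 0 ≤ D * (q - r) := by
        rcases hrq.eq_or_lt with rfl | hlt
        · simp
        · obtain ⟨x, hx⟩ := nonempty_Ioo.2 hlt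
          exact mul_nonneg ((hD x hx).1.le.trans (hD x hx).2) (by linarith)
      linarith
  | switchArc =>
    have harc := Ω.switchArc_piece k hk hkind
    have hcl : closure (Ioo (Ω.t k) (Ω.t (k + 1))) = Icc (Ω.t k) (Ω.t (k + 1)) :=
      closure_Ioo hlt_t.ne
    have h1 : ν ≤ Ω.v s := le_on_closure (fun x hx => by
        rw [harc x hx]
        exact hstar x (hpiece (Ioo_subset_Icc_self hx))) continuousOn_const
      (hcl ▸ Ω.continuousOn.mono hpiece) (hcl ▸ hsk)
    left
    have h2 := pow_le_pow_left₀ hν.le h1 2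
    have h3 := mul_le_mul_of_nonneg_left hs.2 hκ.le
    linarith

theorem v_pos (hε : 0 < ε) {s : ℝ} (hs : s ∈ Ioo 0 P.se) : 0 < Ω.v s := by
  obtain ⟨κ, hκ, h⟩ := Ω.exists_energy_lower_bound hε
  have hs' := Ioo_subset_Icc_self hs
  have hsq : 0 < Ω.v s ^ 2 := by
    rcases h s hs' with h | h
    · exact (mul_pos hκ hs.1).trans_le h
    · exact (mul_pos hκ (sub_pos.2 hs.2)).trans_le h
  exact lt_of_le_of_ne (Ω.feasible.nonneg s hs') fun h => by simp [← h] at hsq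

end CNITrajectory

end PathProblem

/-! ### Traveling times -/

namespace PathProblem

variable {m n : ℕ} {P : PathProblem m n} {ε : ℝ}

theorem travelTime_le_of_le {Γ₁ Γ₂ : Profile} (h : ∀ s ∈ Icc 0 P.se, Γ₂.v s ≤ Γ₁.v s) :
    P.travelTime Γ₁ ≤ P.travelTime Γ₂ :=
  setLIntegral_mono' measurableSet_Icc fun s hs =>
    ENNReal.inv_le_inv.2 (ENNReal.ofReal_le_ofReal (h s hs))

/-- Two ordered trajectories with the same finite traveling time agree. -/
theorem eqOn_of_travelTime_le {Γ₁ Γ₂ : Profile} (h₁ : P.IsProfile Γ₁) (h₂ : P.IsProfile Γ₂)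
    (h : ∀ s ∈ Icc 0 P.se, Γ₂.v s ≤ Γ₁.v s) (hfin : P.travelTime Γ₁ ≠ ∞)
    (hT : P.travelTime Γ₂ ≤ P.travelTime Γ₁) : EqOn Γ₁.v Γ₂.v (Icc 0 P.se) := by
  have hmeas : AEMeasurable (fun s => (ENNReal.ofReal (Γ₂.v s))⁻¹)
      (volume.restrict (Icc 0 P.se)) :=
    (h₂.continuousOn.aemeasurable measurableSet_Icc).ennreal_ofReal.inv
  have hae := ae_eq_of_ae_le_of_lintegral_le
    ((ae_restrict_iff' measurableSet_Icc).2 (Eventually.of_forall fun s hs =>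
      ENNReal.inv_le_inv.2 (ENNReal.ofReal_le_ofReal (h s hs)))) hfin hmeas hT
  refine Measure.eqOn_Icc_of_ae_eq volume P.se_pos.ne ?_ h₁.continuousOn h₂.continuousOn
  filter_upwards [hae, ae_restrict_mem measurableSet_Icc] with s hs hmem
  exact (ENNReal.ofReal_eq_ofReal_iff (h₁.nonneg s hmem) (h₂.nonneg s hmem)).1 (inv_inj.1 hs)

namespace CNITrajectory

variable (Ω : P.CNITrajectory ε)

theorem isTimeOptimalUnder : P.IsTimeOptimalUnder ε Ω.toProfile :=
  ⟨Ω.feasible, fun _ hΓ => travelTime_le_of_le (Ω.le_of_feasible hΓ)⟩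

/-- Starting or stopping at rest makes `1 / v` blow up no faster than an inverse square root, which
is integrable. The majorant adds both end singularities, so either alternative of the energy bound
suffices. -/
theorem travelTime_ne_top (hε : 0 < ε) : P.travelTime Ω.toProfile ≠ ∞ := by
  obtain ⟨κ, hκ, hlow⟩ := Ω.exists_energy_lower_bound hε
  set g : ℝ → ℝ := fun s => (√κ)⁻¹ * (s ^ (-(1 / 2) : ℝ) + (P.se - s) ^ (-(1 / 2) : ℝ))
  have hg : IntervalIntegrable g volume 0 P.se := by
    have h1 : IntervalIntegrable (fun x : ℝ => x ^ (-(1 / 2) : ℝ)) volume 0 P.se :=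
      intervalIntegral.intervalIntegrable_rpow' (by norm_num)
    have h2 := h1.comp_sub_left P.se
    simp only [sub_zero, sub_self] at h2
    exact (h1.add h2.symm).const_mul _
  have hg' : IntegrableOn g (Icc 0 P.se) :=
    (intervalIntegrable_iff_integrableOn_Icc_of_le P.se_pos.le).1 hg
  refine ((setLIntegral_mono_ae' measurableSet_Icc ?_).trans_lt hg'.lintegral_lt_top).ne
  have hends : ∀ᵐ s : ℝ, s ≠ 0 ∧ s ≠ P.se :=
    (Measure.ae_ne volume 0).and (Measure.ae_ne volume P.se)
  filter_upwards [hends] with s hne hs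
  have hs' : s ∈ Ioo 0 P.se := ⟨lt_of_le_of_ne hs.1 hne.1.symm, lt_of_le_of_ne hs.2 hne.2⟩
  have hv := Ω.v_pos hε hs'
  have key : ∀ x, 0 < x → κ * x ≤ Ω.v s ^ 2 → (Ω.v s)⁻¹ ≤ (√κ)⁻¹ * x ^ (-(1 / 2) : ℝ) := by
    intro x hx h
    rw [Real.rpow_neg hx.le, ← Real.sqrt_eq_rpow, ← mul_inv, ← Real.sqrt_mul hκ.le]
    exact inv_anti₀ (Real.sqrt_pos.2 (mul_pos hκ hx)) (Real.sqrt_le_iff.2 ⟨hv.le, h⟩)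
  have h1 : 0 ≤ (√κ)⁻¹ * s ^ (-(1 / 2) : ℝ) := by
    have := hs.1
    positivity
  have h2 : 0 ≤ (√κ)⁻¹ * (P.se - s) ^ (-(1 / 2) : ℝ) := by
    have := sub_nonneg.2 hs.2
    positivity
  rw [← ENNReal.ofReal_inv_of_pos hv]
  refine ENNReal.ofReal_le_ofReal ?_
  simp only [g, mul_add]
  rcases hlow s hs with h | h
  · linarith [key s hs'.1 h]
  · linarith [key _ (sub_pos.2 hs'.2) h]

theorem travelTime_eq_top (hε : ε ≤ 0) : P.travelTime Ω.toProfile = ∞ := by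
  have h : P.travelTime Ω.toProfile = ∫⁻ _ in Icc 0 P.se, ∞ :=
    setLIntegral_congr_fun measurableSet_Icc fun s hs => by
      simp [ENNReal.ofReal_of_nonpos ((Ω.feasible.le_param hs).trans hε)]
  rw [h, setLIntegral_const, Real.volume_Icc, sub_zero]
  exact ENNReal.top_mul (by simpa using P.se_pos)

/-- A trajectory of complete numerical integration that is not the time-optimal motion is beaten
strictly by every one for a larger parameter. -/
theorem travelTime_lt_or_isTimeOptimalMotion {ε₁ ε₂ : ℝ} (hε₁ : 0 < ε₁) (hlt : ε₂ < ε₁)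
    (Ω₁ : P.CNITrajectory ε₁) (Ω₂ : P.CNITrajectory ε₂) :
    P.travelTime Ω₁.toProfile < P.travelTime Ω₂.toProfile ∨
      P.IsTimeOptimalMotion Ω₂.toProfile := by
  rcases lt_or_ge (P.travelTime Ω₁.toProfile) (P.travelTime Ω₂.toProfile) with h | h
  · exact Or.inl h
  have heq : EqOn Ω₁.v Ω₂.v (Icc 0 P.se) :=
    eqOn_of_travelTime_le Ω₁.feasible.toIsProfile Ω₂.feasible.toIsProfile
      (Ω₁.le_of_feasible (Ω₂.feasible.mono hlt.le)) (Ω₁.travelTime_ne_top hε₁) h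
  refine Or.inr ⟨Ω₂.feasible.toIsAdmissible, fun Γ hΓ => travelTime_le_of_le fun s hs => ?_⟩
  rw [← heq hs]
  -- Since `Ω₁` coincides with `Ω₂`, it stays at or below `ε₂`, strictly under its own level line.
  refine Ω₁.le_of_admissible_of_lt hΓ (fun x hx => ?_) s hs
  rw [heq hx]
  exact (Ω₂.feasible.le_param hx).trans_lt hlt

theorem isTimeOptimalMotion_of_maxMVC (Ω : P.CNITrajectory P.maxMVC) :
    P.IsTimeOptimalMotion Ω.toProfile :=
  ⟨Ω.feasible.toIsAdmissible, fun _ hΓ =>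
    Ω.isTimeOptimalUnder.2 _ hΓ.isFeasibleUnder_maxMVC⟩

end CNITrajectory

/-! ### Bidirectional integration in short windows -/

section Smoothing

variable {Ω : P.CNITrajectory ε} {δ : ℝ} {l r : ℕ → ℝ} {Γ : Profile}

theorem IsSmoothing.left_mem (h : IsSmoothing Ω δ l r Γ) {k : ℕ} (hk : Ω.IntersectsAt k) :
    l k ∈ Icc 0 P.se :=
  Ω.piece_subset (k.lt_succ_self.trans hk.1) ⟨(h.left_window k hk).1.le, (h.left_window k hk).2.le⟩

theorem IsSmoothing.right_mem (h : IsSmoothing Ω δ l r Γ) {k : ℕ} (hk : Ω.IntersectsAt k) :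
    r k ∈ Icc 0 P.se :=
  Ω.piece_subset hk.1 ⟨(h.right_window k hk).1.le, (h.right_window k hk).2.le⟩

theorem IsSmoothing.eq_at_left (h : IsSmoothing Ω δ l r Γ) {k : ℕ} (hk : Ω.IntersectsAt k) :
    Γ.v (l k) = Ω.v (l k) := by
  refine h.unchanged _ (h.left_mem hk) fun i hi hmem => ?_
  have hkN := hk.1
  have hiN := hi.1
  -- Only the preceding window shares a piece with `l k`, and non-overlap handles it; all other
  -- windows are separated from `l k` by a breakpoint.
  rcases lt_trichotomy i k with hik | rfl | hik
  · rcases (Nat.succ_le_of_lt hik).eq_or_lt with e | hlt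
    · have e : k = i + 1 := e.symm
      subst e
      exact absurd hmem.2 (not_lt.2 (h.disjoint i hi hk))
    · have h1 := Ω.t_le_t (i := i + 2) (j := k) hlt (by omega)
      linarith [(h.right_window i hi).2, (h.left_window k hk).1, hmem.2]
  · exact lt_irrefl _ hmem.1
  · have h1 := Ω.t_le_t (i := k + 1) (j := i) hik (by omega)
    linarith [(h.left_window k hk).2, (h.left_window i hi).1, hmem.1]

/-- The path from the breakpoint goes back along `Ω` to the left end, where both profiles agree,
then forward along `Γ`; each leg loses at most `K * δ`. -/
theorem IsSmoothing.sq_lower_bound (h : IsSmoothing Ω δ l r Γ) {K e : ℝ} (hK : 0 < K)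
    (hlip : ∀ Γ, P.IsFeasibleUnder ε Γ → ∀ r ∈ Icc 0 P.se, ∀ s ∈ Icc 0 P.se, r ≤ s →
      |Γ.v s ^ 2 - Γ.v r ^ 2| ≤ K * (s - r))
    {k : ℕ} (hk : Ω.IntersectsAt k) (he : e ≤ Ω.v (Ω.t (k + 1)) ^ 2) {s : ℝ}
    (hs : s ∈ Ioo (l k) (r k)) : e - 2 * (K * δ) ≤ Γ.v s ^ 2 := by
  have hl := h.left_mem hk
  have hr := h.right_mem hk
  have hlw := h.left_window k hk
  have hrw := h.right_window k hk
  have hshort := h.short k hk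
  have h1 := (abs_le.1 (hlip Γ h.feasible _ hl s ⟨hl.1.trans hs.1.le, hs.2.le.trans hr.2⟩
    hs.1.le)).1
  have h2 := (abs_le.1 (hlip _ Ω.feasible _ hl _ (Ω.t_mem hk.1.le) hlw.2.le)).2
  have h3 : K * (s - l k) ≤ K * δ := mul_le_mul_of_nonneg_left (by linarith [hs.2]) hK.le
  have h4 : K * (Ω.t (k + 1) - l k) ≤ K * δ :=
    mul_le_mul_of_nonneg_left (by linarith [hrw.1]) hK.le
  rw [h.eq_at_left hk] at h1
  linarith

/-- If the velocity on the windows is at least `μ`, then smoothing adds at most `δ / μ` per window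
to the traveling time. -/
theorem IsSmoothing.travelTime_le (h : IsSmoothing Ω δ l r Γ) {μ : ℝ} (hμ : 0 < μ)
    (hv : ∀ k, Ω.IntersectsAt k → ∀ s ∈ Ioo (l k) (r k), μ ≤ Γ.v s) :
    P.travelTime Γ ≤ P.travelTime Ω.toProfile + ENNReal.ofReal (Ω.N * (μ⁻¹ * δ)) := by
  classical
  set I := (Finset.range Ω.N).filter Ω.IntersectsAt
  set w : ℕ → ℝ → ℝ≥0∞ := fun k => (Ioo (l k) (r k)).indicator fun _ => ENNReal.ofReal μ⁻¹ with hw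
  have hwm : ∀ k, Measurable (w k) := fun k => measurable_const.indicator measurableSet_Ioo
  have hpt : ∀ s ∈ Icc 0 P.se, (ENNReal.ofReal (Γ.v s))⁻¹ ≤
      (ENNReal.ofReal (Ω.v s))⁻¹ + ∑ k ∈ I, w k s := by
    intro s hs
    by_cases hwin : ∃ k, Ω.IntersectsAt k ∧ s ∈ Ioo (l k) (r k)
    · obtain ⟨k, hk, hsk⟩ := hwin
      have hkI : k ∈ I := Finset.mem_filter.2
        ⟨Finset.mem_range.2 (k.lt_succ_self.trans hk.1), hk⟩
      calc (ENNReal.ofReal (Γ.v s))⁻¹ ≤ (ENNReal.ofReal μ)⁻¹ :=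
            ENNReal.inv_le_inv.2 (ENNReal.ofReal_le_ofReal (hv k hk s hsk))
        _ = w k s := by
          simp only [hw, indicator_of_mem hsk, ENNReal.ofReal_inv_of_pos hμ]
        _ ≤ ∑ k ∈ I, w k s := Finset.single_le_sum (f := fun k => w k s) (fun _ _ => zero_le) hkI
        _ ≤ _ := le_add_self
    · push Not at hwin
      rw [h.unchanged s hs hwin]
      exact le_self_add
  have hint : ∀ k ∈ I, ∫⁻ s in Icc 0 P.se, w k s ≤ ENNReal.ofReal (μ⁻¹ * δ) := by
    intro k hk
    calc ∫⁻ s in Icc 0 P.se, w k s ≤ ∫⁻ s, w k s := setLIntegral_le_lintegral _ _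
      _ = ENNReal.ofReal μ⁻¹ * ENNReal.ofReal (r k - l k) := by
        rw [hw, lintegral_indicator_const measurableSet_Ioo, Real.volume_Ioo]
      _ ≤ ENNReal.ofReal μ⁻¹ * ENNReal.ofReal δ := by
        gcongr
        exact (h.short k (Finset.mem_filter.1 hk).2).le
      _ = _ := (ENNReal.ofReal_mul (inv_pos.2 hμ).le).symm
  calc P.travelTime Γ
      ≤ ∫⁻ s in Icc 0 P.se, ((ENNReal.ofReal (Ω.v s))⁻¹ + ∑ k ∈ I, w k s) :=
        setLIntegral_mono' measurableSet_Icc hpt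
    _ = P.travelTime Ω.toProfile + ∑ k ∈ I, ∫⁻ s in Icc 0 P.se, w k s := by
        rw [lintegral_add_right _ (Finset.measurable_fun_sum _ fun k _ => hwm k),
          lintegral_finsetSum _ fun k _ => hwm k]
        rfl
    _ ≤ P.travelTime Ω.toProfile + ENNReal.ofReal (Ω.N * (μ⁻¹ * δ)) := by
        gcongr
        refine (Finset.sum_le_card_nsmul I _ _ hint).trans ?_
        rw [nsmul_eq_mul, ENNReal.ofReal_mul (Nat.cast_nonneg _), ENNReal.ofReal_natCast]
        gcongr
        exact (Finset.card_filter_le _ _).trans (Finset.card_range _).le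

theorem SmoothedFrom.feasible (h : SmoothedFrom Ω δ Γ) : P.IsFeasibleUnder ε Γ :=
  let ⟨_, _, h⟩ := h
  h.feasible

/-- The traveling time of the smoothened trajectories tends to the one of the trajectory of
complete numerical integration as the windows shrink. -/
theorem exists_window_travelTime_le (Ω : P.CNITrajectory ε) {η : ℝ≥0∞} (hη : 0 < η) :
    ∃ δ > 0, ∀ Γ : Profile, SmoothedFrom Ω δ Γ →
      P.travelTime Γ ≤ P.travelTime Ω.toProfile + η := by
  rcases le_or_gt ε 0 with hε | hε
  · exact ⟨1, one_pos, fun Γ _ => by simp [Ω.travelTime_eq_top hε]⟩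
  rcases eq_or_ne η ∞ with rfl | hη'
  · exact ⟨1, one_pos, fun Γ _ => by simp⟩
  classical
  obtain ⟨K, hK, hlip⟩ := P.exists_energy_lipschitz ε
  -- `e` bounds v² from below at the interior breakpoints; the value 1 fills the last index, which
  -- belongs to the end of the path.
  obtain ⟨e, he, hle⟩ := exists_pos_le
    (f := fun k : Fin Ω.N => if (k : ℕ) + 1 < Ω.N then Ω.v (Ω.t (k + 1)) ^ 2 else 1) (by
      intro k
      split_ifs with hk
      · refine pow_pos (Ω.v_pos hε ⟨?_, ?_⟩) 2
        · exact (Ω.t_mem (by omega)).1.trans_lt (Ω.t_lt k (by omega))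
        · exact (Ω.t_lt (k + 1) hk).trans_le (Ω.t_mem hk).2
      · exact one_pos)
  have hμ : 0 < √(e / 2) := Real.sqrt_pos.2 (by positivity)
  have hηr : 0 < η.toReal := ENNReal.toReal_pos hη.ne' hη'
  -- The first entry limits the loss of v² to `e / 2`, so the velocity in windows is at least `√(e /
  -- 2)`; the second keeps the total cost of at most `Ω.N` windows below `η`.
  refine ⟨min (e / (4 * K)) (η.toReal * √(e / 2) / (Ω.N + 1)), by positivity, ?_⟩
  rintro Γ ⟨l, r, h⟩
  set δ := min (e / (4 * K)) (η.toReal * √(e / 2) / (Ω.N + 1))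
  have hδ1 : K * δ ≤ e / 4 := by
    have : K * δ ≤ K * (e / (4 * K)) := mul_le_mul_of_nonneg_left (min_le_left _ _) hK.le
    rwa [show K * (e / (4 * K)) = e / 4 by field_simp] at this
  have hδ2 : δ * (Ω.N + 1) ≤ η.toReal * √(e / 2) :=
    (le_div_iff₀ (by positivity)).1 (min_le_right _ _)
  have hδ0 : 0 ≤ δ := le_min (by positivity) (by positivity)
  refine (h.travelTime_le hμ fun k hk s hs => ?_).trans ?_
  · have hkN := hk.1
    have h1 := hle ⟨k, by omega⟩
    simp only [hkN, if_true] at h1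
    have h2 := h.sq_lower_bound hK hlip hk h1 hs
    have hs' : s ∈ Icc 0 P.se :=
      ⟨(h.left_mem hk).1.trans hs.1.le, hs.2.le.trans (h.right_mem hk).2⟩
    exact Real.sqrt_le_iff.2 ⟨h.feasible.nonneg s hs', by linarith⟩
  · refine add_le_add_right (ENNReal.ofReal_le_of_le_toReal ?_) _
    rw [mul_comm (√(e / 2))⁻¹, ← mul_assoc, ← div_eq_mul_inv, div_le_iff₀ hμ]
    linarith

end Smoothing

end PathProblem

end

theorem theorem3 {m n : ℕ} (P : PathProblem m n) :
    -- the trajectory of complete numerical integration is time-optimal under `MVC*`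
    (∀ ε ∈ P.paramRange, ∀ Ω : P.CNITrajectory ε, P.IsTimeOptimalUnder ε Ω.toProfile) ∧
    -- the traveling time decreases, strictly so until the time-optimal motion is achieved
    (∀ ε₁ ∈ P.paramRange, ∀ ε₂ ∈ P.paramRange, ε₂ < ε₁ →
      ∀ (Ω₁ : P.CNITrajectory ε₁) (Ω₂ : P.CNITrajectory ε₂),
        P.travelTime Ω₁.toProfile ≤ P.travelTime Ω₂.toProfile ∧
        (P.travelTime Ω₁.toProfile < P.travelTime Ω₂.toProfile ∨
          P.IsTimeOptimalMotion Ω₂.toProfile)) ∧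
    -- the time-optimal motion is achieved at `ε = Max(MVC)`
    (∀ Ω : P.CNITrajectory P.maxMVC, P.IsTimeOptimalMotion Ω.toProfile) ∧
    -- the smoothened trajectories: same monotonicity, for short enough smoothing windows
    (∀ ε₁ ∈ P.paramRange, ∀ ε₂ ∈ P.paramRange, ε₂ < ε₁ →
      ∀ (Ω₁ : P.CNITrajectory ε₁) (Ω₂ : P.CNITrajectory ε₂),
        P.IsTimeOptimalMotion Ω₂.toProfile ∨
        ∃ δ > 0, ∀ Γ₁ Γ₂ : Profile, PathProblem.SmoothedFrom Ω₁ δ Γ₁ →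
          PathProblem.IsGeneratedFrom Ω₂ Γ₂ → P.travelTime Γ₁ < P.travelTime Γ₂) ∧
    -- and their traveling time tends to the optimal one as the windows shrink
    (∀ ε ∈ P.paramRange, ∀ Ω : P.CNITrajectory ε, ∀ η : ℝ≥0∞, 0 < η →
      ∃ δ > 0, ∀ Γ : Profile, PathProblem.SmoothedFrom Ω δ Γ →
        P.travelTime Ω.toProfile ≤ P.travelTime Γ ∧
        P.travelTime Γ ≤ P.travelTime Ω.toProfile + η) := by
  have hpos : ∀ ε₁ ε₂, ε₂ ∈ P.paramRange → ε₂ < ε₁ → 0 < ε₁ := fun ε₁ ε₂ h hlt =>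
    ((P.v0_nonneg.trans (le_max_left _ _)).trans h.1).trans_lt hlt
  refine ⟨fun ε _ Ω => Ω.isTimeOptimalUnder, fun ε₁ _ ε₂ h₂ hlt Ω₁ Ω₂ => ⟨?_, ?_⟩,
    fun Ω => Ω.isTimeOptimalMotion_of_maxMVC, fun ε₁ _ ε₂ h₂ hlt Ω₁ Ω₂ => ?_,
    fun ε _ Ω η hη => ?_⟩
  · exact Ω₁.isTimeOptimalUnder.2 _ (Ω₂.feasible.mono hlt.le)
  · exact PathProblem.CNITrajectory.travelTime_lt_or_isTimeOptimalMotion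
      (hpos ε₁ ε₂ h₂ hlt) hlt Ω₁ Ω₂
  · rcases PathProblem.CNITrajectory.travelTime_lt_or_isTimeOptimalMotion
      (hpos ε₁ ε₂ h₂ hlt) hlt Ω₁ Ω₂ with h | h
    · obtain ⟨c, hc₁, hc₂⟩ := exists_between h
      obtain ⟨δ, hδ, H⟩ := PathProblem.exists_window_travelTime_le Ω₁ (tsub_pos_of_lt hc₁)
      refine Or.inr ⟨δ, hδ, fun Γ₁ Γ₂ hΓ₁ hΓ₂ => ?_⟩
      obtain ⟨_, hΓ₂⟩ := hΓ₂
      calc P.travelTime Γ₁ ≤ P.travelTime Ω₁.toProfile + (c - P.travelTime Ω₁.toProfile) :=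
            H Γ₁ hΓ₁
        _ = c := add_tsub_cancel_of_le hc₁.le
        _ < P.travelTime Ω₂.toProfile := hc₂
        _ ≤ P.travelTime Γ₂ := Ω₂.isTimeOptimalUnder.2 _ hΓ₂.feasible
    · exact Or.inl h
  · obtain ⟨δ, hδ, H⟩ := PathProblem.exists_window_travelTime_le Ω hη
    exact ⟨δ, hδ, fun Γ hΓ => ⟨Ω.isTimeOptimalUnder.2 _ hΓ.feasible, H Γ hΓ⟩⟩
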